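/- Let $\lambda\in\mathbb R\setminus\{0\}$ and let $G$ be a (finite-dimensional real) Lie group with Lie algebra $\mathfrak g$. For $g,h\in G$ say that $h$ is a value of $g^{\lambda}$ if either $g=\exp(u)$ and $h=\exp(\lambda u)$ for some $u\in\mathfrak g$, or $\lambda=p/q$ is a rational number in lowest terms ($q\ge 1$) and $h^{q}=g^{p}$. Suppose that $f(g)=g^{\lambda}$ is a well-defined bijection $f\colon G\to G$, that is, every $g\in G$ has exactly one value $f(g)$ of $g^\lambda$, and $f$ is bijective. Let $g\ast h=f^{-1}(f(g)f(h))=(g^{\lambda}h^{\lambda})^{1/\lambda}$. Let $\mathcal B\colon G\to G$ be a smooth Rota--Baxter operator of weight $\lambda$ on $G$, i.e. a smooth map with $$\mathcal B(g)\,\mathcal B(h)=\mathcal B\bigl(g\ast(\mathcal B(g)\,h\,\mathcal B(g)^{-1})\bigr)\qquad\text{for all } g,h\in G.$$ Then $\mathcal B(1_G)=1_G$, and the differential $B=\mathcal B_{*1_G}\colon\mathfrak g\to\mathfrak g$ of $\mathcal B$ at the identity is a Rota--Baxter operator of weight $\lambda$ on the Lie algebra $\mathfrak g$, i.e. $B$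 is linear and $$[B(u),B(v)]=B\bigl([B(u),v]-[B(v),u]+\lambda[u,v]\bigr)\qquad\text{for all } u,v\in\mathfrak g.$$ -/

import Mathlib

open scoped Manifold ContDiff

/-- Over `ℝ`, `minSmoothness ℝ 3` is `3`, so a smooth Lie group has the regularity under which
Mathlib puts a Lie algebra structure on `GroupLieAlgebra I G`. -/
instance instLEInftyMinSmoothnessRealThree : ENat.LEInfty (minSmoothness ℝ 3) where
  out := by
    rw [minSmoothness_of_isRCLikeNormedField]
    exact ENat.LEInfty.out

/-- A linear endomorphism `B` of a Lie algebra `L` is a Rota–Baxter operator of weight `c` if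
`[B u, B v] = B ([B u, v] - [B v, u] + c [u, v])` for all `u, v`. -/
def IsLieRotaBaxterOperator {R L : Type*} [CommRing R] [LieRing L] [LieAlgebra R L]
    (c : R) (B : L →ₗ[R] L) : Prop :=
  ∀ u v : L, ⁅B u, B v⁆ = B (⁅B u, v⁆ - ⁅B v, u⁆ + c • ⁅u, v⁆)

section LieGroupPowers

variable {E : Type*} [NormedAddCommGroup E] [NormedSpace ℝ E]
  {H : Type*} [TopologicalSpace H] (I : ModelWithCorners ℝ E H)
  {G : Type*} [TopologicalSpace G] [ChartedSpace H G] [Group G]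

/-- A one-parameter subgroup `t ↦ exp (t u)` of a Lie group: a smooth homomorphism from
`(ℝ, +)`. -/
structure IsOneParameterSubgroup (γ : ℝ → G) : Prop where
  contMDiff : ContMDiff 𝓘(ℝ, ℝ) I ∞ γ
  map_add : ∀ s t : ℝ, γ (s + t) = γ s * γ t

/-- `h` is a value of the real power `g ^ c`: either `g = exp u` and `h = exp (c u)` for some `u`
in the Lie algebra (written with the one-parameter subgroup `γ t = exp (t u)`), or `c = p / q` is
rational, in lowest terms with `q ≥ 1`, and `h ^ q = g ^ p`. In particular, for an integer `c`
the only value is the usual power. -/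
def IsRealPower (c : ℝ) (g h : G) : Prop :=
  (∃ γ : ℝ → G, IsOneParameterSubgroup I γ ∧ γ 1 = g ∧ γ c = h) ∨
    (∃ r : ℚ, (r : ℝ) = c ∧ h ^ r.den = g ^ r.num)

/-- The map `g ↦ g ^ c` is well defined (every `g` has exactly one `c`-th power) and it is the
bijection `f`. -/
def IsPowerBijection (c : ℝ) (f : G ≃ G) : Prop :=
  ∀ g h : G, IsRealPower I c g h ↔ f g = h

/-- The group operation `g ∗ h = f⁻¹ (f g · f h)` transported along a bijection `f`. For
`f g = g ^ c` it is `(g ^ c h ^ c) ^ (1 / c)`. -/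
def transportedMul {G : Type*} [Group G] (f : G ≃ G) (g h : G) : G :=
  f.symm (f g * f h)

/-- `𝓑 : G → G` is a Rota–Baxter operator of weight `c` on the group `G`: the map
`f g = g ^ c` is a well-defined bijection of `G`, and
`𝓑 g · 𝓑 h = 𝓑 (g ∗ (𝓑 g · h · (𝓑 g)⁻¹))` for the transported product `∗`. -/
def IsGroupRotaBaxterOperator (c : ℝ) (𝓑 : G → G) : Prop :=
  ∃ f : G ≃ G, IsPowerBijection I c f ∧
    ∀ g h : G, 𝓑 g * 𝓑 h = 𝓑 (transportedMul f g (𝓑 g * h * (𝓑 g)⁻¹))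

/-- The differential at the identity of a map `𝓑 : G → G`. As a linear map it goes from the
tangent space at `1` to the tangent space at `𝓑 1`, so as an endomorphism of the Lie algebra it is
only meaningful when `𝓑 1 = 1`, which is therefore asked for. -/
noncomputable def differentialAtOne (𝓑 : G → G) (_h : 𝓑 1 = 1) :
    GroupLieAlgebra I G →ₗ[ℝ] GroupLieAlgebra I G :=
  (mfderiv I I 𝓑 (1 : G) : TangentSpace I (1 : G) →L[ℝ] TangentSpace I (𝓑 1)).toLinearMap

end LieGroupPowers

/-! The Lie bracket is visible in the second order part of the group law: in a chart centred at `1`,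
the product is `x + y + β(x, y) + o(‖x‖ ‖y‖)` and `[u, v] = β(u, v) - β(v, u)`. So the Rota–Baxter
identity only has to be expanded to order `ε ^ 2` along the curves with coordinates `ε u` and `ε v`.
The one ingredient that is not smooth by hypothesis is the power bijection `f`. It satisfies `f (exp
u) = exp (c u)`, and `exp` has the expansion `u + β(u, u) / 2 + o(‖u‖ ^ 2)` with a local inverse of
the same kind, so `f` maps the two-jet `(a, b)` to `(c a, c b + (c ^ 2 - c) / 2 β(a, a))`
(`exists_lieExp_hasLieTwoJet`). Peano expansions along curves suffice; second derivatives of `exp`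
are never needed. Comparing coefficients (`IsGroupRotaBaxterOperator.exists_second_order`) expresses
`β(B u, B v)` through `B` and `β`, up to terms symmetric in `u, v`: the second derivative of `𝓑` and
the symmetric part of `β`. Antisymmetrising removes these and leaves the Lie algebra identity. -/

open Filter Topology Set Asymptotics

/-! ### Second order estimates in normed spaces -/

section Analysis

variable {E : Type*} [NormedAddCommGroup E] [NormedSpace ℝ E]
  {F : Type*} [NormedAddCommGroup F] [NormedSpace ℝ F]

/-- If `V` is strictly differentiable at `0` and the curves `x u` solve `x' = V x u`, `x 0 = 0`
for small `u`, then `u ↦ x u 1` is strictly differentiable at `0`. -/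
theorem hasStrictFDerivAt_ode_endpoint {V : E → E →L[ℝ] E} {V' : E →L[ℝ] E →L[ℝ] E}
    (hV : HasStrictFDerivAt V V' 0) (hV0 : V 0 = ContinuousLinearMap.id ℝ E) {x : E → ℝ → E}
    (h0 : ∀ u, x u 0 = 0)
    (hx : ∀ᶠ u in 𝓝 (0 : E), ∀ t ∈ Icc (0 : ℝ) 1,
      HasDerivAt (x u) (V (x u t) u) t ∧ ‖x u t‖ ≤ 2 * ‖u‖) :
    HasStrictFDerivAt (fun u => x u 1) (ContinuousLinearMap.id ℝ E) 0 := by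
  obtain ⟨K, s, hs, hK⟩ := hV.exists_lipschitzOnWith
  obtain ⟨ρ, hρ, hρs⟩ := Metric.nhds_basis_closedBall.mem_iff.1 hs
  obtain ⟨δ, hδ, hδx⟩ := Metric.nhds_basis_ball.mem_iff.1 hx
  have hK0 : (0 : ℝ) ≤ K := K.2
  refine HasStrictFDerivAt.of_isLittleO (isLittleO_iff.2 fun ε hε => ?_)
  -- `2 * r ≤ ρ` keeps the curves in `s`; `4 * K * r ≤ 1` allows absorption in `hM`; `6 = 2 + 4`
  -- adds up the two error terms at the end.
  obtain ⟨r, hr, hr1, hr2, hr3, hr4⟩ : ∃ r : ℝ, 0 < r ∧ r ≤ δ ∧ 2 * r ≤ ρ ∧ 6 * K * r ≤ ε ∧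
      4 * K * r ≤ 1 := by
    refine ⟨min (min δ (ρ / 2)) (min ε 1 / (6 * K + 1)), by positivity, ?_, ?_, ?_, ?_⟩
    · exact (min_le_left _ _).trans (min_le_left _ _)
    · have := (min_le_left (min δ (ρ / 2)) (min ε 1 / (6 * K + 1))).trans (min_le_right _ _)
      linarith
    all_goals
      have h1 := min_le_right (min δ (ρ / 2)) (min ε 1 / (6 * K + 1))
      set q := min (min δ (ρ / 2)) (min ε 1 / (6 * K + 1)) with hq
      have hq0 : 0 < q := by positivity
      rw [le_div_iff₀ (by positivity)] at h1
      have h2 := min_le_left ε 1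
      have h3 := min_le_right ε 1
      nlinarith
  have hball : Metric.ball (0 : E) r ×ˢ Metric.ball (0 : E) r ∈ 𝓝 ((0 : E), (0 : E)) :=
    prod_mem_nhds (Metric.ball_mem_nhds _ hr) (Metric.ball_mem_nhds _ hr)
  filter_upwards [hball] with ⟨u, v⟩ ⟨hu, hv⟩
  have hxu := hδx (Metric.ball_subset_ball hr1 hu)
  have hxv := hδx (Metric.ball_subset_ball hr1 hv)
  simp only [mem_ball_zero_iff] at hu hv
  have mem : ∀ w : E, ‖w‖ < r → ∀ y : E, ‖y‖ ≤ 2 * ‖w‖ → y ∈ s := fun w hw y hy =>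
    hρs (by rw [mem_closedBall_zero_iff]; linarith)
  have hVu : ∀ t ∈ Icc (0 : ℝ) 1, ‖V (x u t) - ContinuousLinearMap.id ℝ E‖ ≤ K * (2 * ‖u‖) := by
    intro t ht
    have := hK.norm_sub_le (mem u hu _ (hxu t ht).2) (mem_of_mem_nhds hs)
    rw [hV0, sub_zero] at this
    exact this.trans (by have := (hxu t ht).2; gcongr)
  have hcont : ContinuousOn (fun t => x u t - x v t) (Icc 0 1) := fun t ht =>
    ((hxu t ht).1.sub (hxv t ht).1).continuousAt.continuousWithinAt
  -- This replaces Grönwall: the distance of the two curves is bounded by its maximum, reached at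
  -- `τ`. The integrated estimate at `τ` then bounds that maximum by itself times at most `1 / 4`,
  -- plus a multiple of `‖u - v‖`.
  obtain ⟨τ, hτ, hmax⟩ := isCompact_Icc.exists_isMaxOn (nonempty_Icc.2 zero_le_one) hcont.norm
  have key : ∀ t ∈ Icc (0 : ℝ) 1, ‖(V (x u t) u - V (x v t) v) - (u - v)‖ ≤
      K * (2 * ‖u‖) * ‖u - v‖ + K * ‖x u τ - x v τ‖ * ‖v‖ := by
    intro t ht
    have e : (V (x u t) u - V (x v t) v) - (u - v) =
        (V (x u t) - ContinuousLinearMap.id ℝ E) (u - v) + (V (x u t) - V (x v t)) v := by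
      simp; abel
    rw [e]
    refine (norm_add_le _ _).trans (add_le_add ?_ ?_)
    · exact ((V (x u t) - ContinuousLinearMap.id ℝ E).le_opNorm _).trans (by gcongr; exact hVu t ht)
    · refine ((V (x u t) - V (x v t)).le_opNorm _).trans ?_
      gcongr
      refine (hK.norm_sub_le (mem u hu _ (hxu t ht).2) (mem v hv _ (hxv t ht).2)).trans ?_
      gcongr
      exact hmax ht
  have hd : ∀ t ∈ Icc (0 : ℝ) 1,
      ‖x u t - x v t - t • (u - v)‖ ≤
        (K * (2 * ‖u‖) * ‖u - v‖ + K * ‖x u τ - x v τ‖ * ‖v‖) * t := by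
    intro t ht
    have hder : ∀ t ∈ Icc (0 : ℝ) 1, HasDerivWithinAt (fun t => x u t - x v t - t • (u - v))
        ((V (x u t) u - V (x v t) v) - (u - v)) (Icc 0 1) t := fun t ht => by
      have h2 : HasDerivAt (fun t : ℝ => t • (u - v)) (u - v) t := by
        simpa using (hasDerivAt_id t).smul_const (u - v)
      exact (((hxu t ht).1.sub (hxv t ht).1).sub h2).hasDerivWithinAt
    have := norm_image_sub_le_of_norm_deriv_le_segment' hder
      (fun t ht => key t (Ico_subset_Icc_self ht)) t ht
    simpa [h0] using this
  have hM : ‖x u τ - x v τ‖ ≤ 4 * ‖u - v‖ := by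
    have h1 := hd τ hτ
    have h2 : ‖x u τ - x v τ‖ ≤ ‖x u τ - x v τ - τ • (u - v)‖ + ‖τ • (u - v)‖ := by
      simpa using norm_add_le (x u τ - x v τ - τ • (u - v)) (τ • (u - v))
    have h3 : ‖τ • (u - v)‖ ≤ ‖u - v‖ := by
      rw [norm_smul, Real.norm_of_nonneg hτ.1]
      exact mul_le_of_le_one_left (norm_nonneg _) hτ.2
    have h4 : (K * (2 * ‖u‖) * ‖u - v‖ + K * ‖x u τ - x v τ‖ * ‖v‖) * τ ≤
        K * (2 * ‖u‖) * ‖u - v‖ + K * ‖x u τ - x v τ‖ * ‖v‖ :=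
      mul_le_of_le_one_right (by positivity) hτ.2
    have h5 : K * (2 * ‖u‖) ≤ 1 := by nlinarith
    have h6 : K * ‖v‖ ≤ 1 / 4 := by nlinarith
    have h7 := norm_nonneg (u - v)
    have h8 := norm_nonneg (x u τ - x v τ)
    nlinarith
  have h1 := hd 1 (right_mem_Icc.2 zero_le_one)
  simp only [one_smul, mul_one] at h1
  refine h1.trans ?_
  have h7 := norm_nonneg (u - v)
  have h5 : K * (2 * ‖u‖) * ‖u - v‖ ≤ 2 * K * r * ‖u - v‖ := by
    have : (K : ℝ) * (2 * ‖u‖) ≤ 2 * K * r := by nlinarith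
    gcongr
  have h6 : K * ‖x u τ - x v τ‖ * ‖v‖ ≤ K * (4 * ‖u - v‖) * r := by gcongr
  have h9 : 6 * K * r * ‖u - v‖ ≤ ε * ‖u - v‖ := by gcongr
  have : ‖(u, v).1 - (u, v).2‖ = ‖u - v‖ := rfl
  rw [this]
  linarith

/-- Second order expansion of the endpoint `x u 1` of the solutions of `x' = V x u`, `x 0 = 0`. -/
theorem isLittleO_ode_endpoint {V : E → E →L[ℝ] E} {V' : E →L[ℝ] E →L[ℝ] E}
    (hV : HasStrictFDerivAt V V' 0) (hV0 : V 0 = ContinuousLinearMap.id ℝ E) {x : E → ℝ → E}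
    (h0 : ∀ u, x u 0 = 0)
    (hx : ∀ᶠ u in 𝓝 (0 : E), ∀ t ∈ Icc (0 : ℝ) 1,
      HasDerivAt (x u) (V (x u t) u) t ∧ ‖x u t‖ ≤ 2 * ‖u‖) :
    (fun u => x u 1 - u - (2⁻¹ : ℝ) • V' u u) =o[𝓝 0] fun u => ‖u‖ ^ 2 := by
  obtain ⟨K, s, hs, hK⟩ := hV.exists_lipschitzOnWith
  have hK0 : (0 : ℝ) ≤ K := K.2
  refine isLittleO_iff.2 fun ε hε => ?_
  have hη := hV.hasFDerivAt.isLittleO.def (c := ε / 4) (by positivity)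
  simp only [sub_zero, hV0] at hη
  -- As `‖x u t‖ ≤ 2 * ‖u‖`, what holds near `0` holds along the whole curve once `u` is small.
  have hdouble : ∀ {p : E → Prop}, (∀ᶠ y in 𝓝 (0 : E), p y) →
      ∀ᶠ u in 𝓝 (0 : E), ∀ y, ‖y‖ ≤ 2 * ‖u‖ → p y := by
    intro p hp
    obtain ⟨ρ, hρ, hρp⟩ := Metric.nhds_basis_ball.mem_iff.1 hp
    filter_upwards [Metric.ball_mem_nhds (0 : E) (half_pos hρ)] with u hu y hy
    rw [mem_ball_zero_iff] at hu
    exact hρp (by rw [mem_ball_zero_iff]; linarith)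
  have hsmall : ∀ᶠ u in 𝓝 (0 : E), 2 * (K : ℝ) * ‖V'‖ * ‖u‖ < ε / 2 := by
    have : Tendsto (fun u : E => 2 * (K : ℝ) * ‖V'‖ * ‖u‖) (𝓝 0) (𝓝 (2 * (K : ℝ) * ‖V'‖ * ‖(0 : E)‖)) :=
      (by fun_prop : Continuous fun u : E => 2 * (K : ℝ) * ‖V'‖ * ‖u‖).tendsto 0
    exact this.eventually_lt_const (by simpa using half_pos hε)
  filter_upwards [hx, hdouble hη, hdouble hs, hsmall] with u hxu hηu hsu hsm
  have hVx : ∀ t ∈ Icc (0 : ℝ) 1, ‖V (x u t) - ContinuousLinearMap.id ℝ E‖ ≤ K * (2 * ‖u‖) := by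
    intro t ht
    have := hK.norm_sub_le (hsu _ (hxu t ht).2) (mem_of_mem_nhds hs)
    rw [hV0, sub_zero] at this
    exact this.trans (by have := (hxu t ht).2; gcongr)
  have hlin : ∀ t : ℝ, HasDerivAt (fun t : ℝ => t • u) u t := fun t => by
    simpa using (hasDerivAt_id t).smul_const u
  -- A first order estimate of the curve, fed back into the equation to replace `V' (x u t) u` by `t
  -- • V' u u`.
  have h1 : ∀ t ∈ Icc (0 : ℝ) 1, ‖x u t - t • u‖ ≤ 2 * K * ‖u‖ ^ 2 := by
    intro t ht
    have := norm_image_sub_le_of_norm_deriv_le_segment' (f := fun t => x u t - t • u)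
      (f' := fun t => V (x u t) u - u) (C := 2 * K * ‖u‖ ^ 2)
      (fun t ht => ((hxu t ht).1.sub (hlin t)).hasDerivWithinAt) ?_ t ht
    · simp only [h0, zero_smul, sub_zero] at this
      exact this.trans (mul_le_of_le_one_right (by positivity) ht.2)
    · intro t ht
      have h2 := (V (x u t) - ContinuousLinearMap.id ℝ E).le_opNorm u
      have h3 := hVx t (Ico_subset_Icc_self ht)
      calc ‖V (x u t) u - u‖ ≤ ‖V (x u t) - ContinuousLinearMap.id ℝ E‖ * ‖u‖ := by simpa using h2
        _ ≤ K * (2 * ‖u‖) * ‖u‖ := by gcongr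
        _ = _ := by ring
  have hquad : ∀ t : ℝ, HasDerivAt (fun t : ℝ => (t ^ 2 / 2) • V' u u) (t • V' u u) t := fun t => by
    have := (((hasDerivAt_id t).pow 2).div_const 2).smul_const (V' u u)
    convert! this using 1
    congr 1
    simp
  have h2 := norm_image_sub_le_of_norm_deriv_le_segment'
      (f := fun t => x u t - t • u - (t ^ 2 / 2) • V' u u)
      (f' := fun t => V (x u t) u - u - t • V' u u) (C := ε * ‖u‖ ^ 2) (a := 0) (b := 1)
      (fun t ht => (((hxu t ht).1.sub (hlin t)).sub (hquad t)).hasDerivWithinAt) ?_ 1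
      (right_mem_Icc.2 zero_le_one)
  · simpa [h0, norm_pow] using h2
  · intro t ht
    have ht := Ico_subset_Icc_self ht
    have e : V (x u t) u - u - t • V' u u =
        (V (x u t) - ContinuousLinearMap.id ℝ E - V' (x u t)) u + V' (x u t - t • u) u := by
      simp
    rw [e]
    have h3 := (V (x u t) - ContinuousLinearMap.id ℝ E - V' (x u t)).le_opNorm u
    have h4 := hηu _ (hxu t ht).2
    have h5 := V'.le_opNorm₂ (x u t - t • u) u
    have h6 := h1 t ht
    have h7 := (hxu t ht).2
    calc _ ≤ ε / 4 * ‖x u t‖ * ‖u‖ + ‖V'‖ * ‖x u t - t • u‖ * ‖u‖ :=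
          (norm_add_le _ _).trans (add_le_add (h3.trans (by gcongr)) h5)
      _ ≤ ε / 4 * (2 * ‖u‖) * ‖u‖ + ‖V'‖ * (2 * K * ‖u‖ ^ 2) * ‖u‖ := by gcongr
      _ = ε / 2 * ‖u‖ ^ 2 + (2 * K * ‖V'‖ * ‖u‖) * ‖u‖ ^ 2 := by ring
      _ ≤ ε / 2 * ‖u‖ ^ 2 + (ε / 2) * ‖u‖ ^ 2 := by gcongr
      _ = _ := by ring

/-- Second order Taylor expansion with Peano remainder. -/
theorem ContDiffAt.exists_isLittleO_sq {f : E → F} (hf : ContDiffAt ℝ 2 f 0) :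
    ∃ Q : E →L[ℝ] E →L[ℝ] F,
      (fun x => f x - f 0 - fderiv ℝ f 0 x - Q x x) =o[𝓝 0] fun x => ‖x‖ ^ 2 := by
  set D := fderiv ℝ (fderiv ℝ f) 0 with hD
  have hsymm : ∀ v w, D v w = D w v := fun v w =>
    (hf.isSymmSndFDerivAt (by simp)).eq v w
  have hD' : HasFDerivAt (fderiv ℝ f) D 0 :=
    ((hf.fderiv_right (m := 1) (by norm_num)).differentiableAt (by norm_num)).hasFDerivAt
  refine ⟨(2⁻¹ : ℝ) • D, isLittleO_iff.2 fun ε hε => ?_⟩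
  have h1 := hD'.isLittleO.def hε
  have h2 : ∀ᶠ x in 𝓝 (0 : E), DifferentiableAt ℝ f x :=
    (hf.eventually (by simp)).mono fun x hx => hx.differentiableAt (by norm_num)
  obtain ⟨r, hr, hrs⟩ := Metric.nhds_basis_ball.mem_iff.1 (h1.and h2)
  filter_upwards [Metric.ball_mem_nhds (0 : E) hr] with x hx
  have hder : ∀ y ∈ Metric.closedBall (0 : E) ‖x‖, HasFDerivWithinAt
      (fun y => f y - f 0 - fderiv ℝ f 0 y - ((2⁻¹ : ℝ) • D) y y)
      (fderiv ℝ f y - fderiv ℝ f 0 - D y) (Metric.closedBall (0 : E) ‖x‖) y := by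
    intro y hy
    rw [mem_ball_zero_iff] at hx
    rw [mem_closedBall_zero_iff] at hy
    have hy' := (hrs (show y ∈ Metric.ball 0 r by rw [mem_ball_zero_iff]; linarith)).2
    -- Symmetry of the second derivative merges the two halves of the product rule.
    have hq : HasFDerivAt (fun y => ((2⁻¹ : ℝ) • D) y y) (D y) y := by
      have := ((2⁻¹ : ℝ) • D).hasFDerivAt_of_bilinear (hasFDerivAt_id y) (hasFDerivAt_id y)
      convert! this using 1
      ext z
      simp [hsymm z y, ← add_smul]
      norm_num
    exact (((hy'.hasFDerivAt.sub_const _).sub (fderiv ℝ f 0).hasFDerivAt).sub hq).hasFDerivWithinAt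
  have := (convex_closedBall (0 : E) ‖x‖).norm_image_sub_le_of_norm_hasFDerivWithin_le
    (C := ε * ‖x‖) hder ?_ (Metric.mem_closedBall_self (norm_nonneg _))
    (show x ∈ Metric.closedBall (0 : E) ‖x‖ by simp)
  · simpa [pow_two, mul_assoc] using this
  · intro y hy
    rw [mem_ball_zero_iff] at hx
    rw [mem_closedBall_zero_iff] at hy
    have hy' := (hrs (show y ∈ Metric.ball 0 r by rw [mem_ball_zero_iff]; linarith)).1
    rw [sub_zero] at hy'
    exact hy'.trans (by gcongr)

/-- A local product `m` with neutral element `0` satisfies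
`m (x, y) = x + y + b (x, y) + o (‖x‖ ‖y‖)`, where `b` is the mixed second derivative. -/
theorem isLittleO_local_mul {m : E × E → E} (hm : ContDiffAt ℝ 2 m 0)
    (hl : ∀ᶠ y in 𝓝 (0 : E), m (0, y) = y) (hr : ∀ᶠ x in 𝓝 (0 : E), m (x, 0) = x) :
    (fun p : E × E => m p - p.1 - p.2 -
        fderiv ℝ (fun x => fderiv ℝ (fun y => m (x, y)) 0) 0 p.1 p.2)
      =o[𝓝 0] fun p => ‖p.1‖ * ‖p.2‖ := by
  obtain ⟨D, hD⟩ : ∃ D, HasStrictFDerivAt (fderiv ℝ m) D 0 :=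
    ⟨_, (hm.fderiv_right (m := 1) (by norm_num)).hasStrictFDerivAt (by norm_num)⟩
  set ι := ContinuousLinearMap.inr ℝ E E
  set R := (ContinuousLinearMap.compL ℝ E (E × E) E).flip ι
  have hG : HasStrictFDerivAt (fun p => (fderiv ℝ m p).comp ι) (R.comp D) 0 :=
    R.hasStrictFDerivAt.comp _ hD
  have hdiff : ∀ᶠ p in 𝓝 (0 : E × E), DifferentiableAt ℝ m p :=
    (hm.eventually (by simp)).mono fun x hx => hx.differentiableAt (by norm_num)
  have hpart : ∀ p : E × E, DifferentiableAt ℝ m p →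
      HasFDerivAt (fun y => m (p.1, y)) ((fderiv ℝ m p).comp ι) p.2 := fun p hp => by
    have h1 : HasFDerivAt (fun y : E => (p.1, y)) ι p.2 := hasFDerivAt_prodMk_right p.1 p.2
    exact HasFDerivAt.comp p.2 (g := m) (f := fun y => (p.1, y)) hp.hasFDerivAt h1
  have hinl : Tendsto (fun x : E => (x, (0 : E))) (𝓝 0) (𝓝 0) :=
    (by fun_prop : Continuous fun x : E => (x, (0 : E))).tendsto' _ _ rfl
  have hinr : Tendsto (fun y : E => ((0 : E), y)) (𝓝 0) (𝓝 0) :=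
    (by fun_prop : Continuous fun y : E => ((0 : E), y)).tendsto' _ _ rfl
  have hbeta : fderiv ℝ (fun x => fderiv ℝ (fun y => m (x, y)) 0) 0 =
      (R.comp D).comp (ContinuousLinearMap.inl ℝ E E) := by
    have h1 : (fun x => fderiv ℝ (fun y => m (x, y)) 0) =ᶠ[𝓝 0]
        fun x => (fderiv ℝ m (x, 0)).comp ι := by
      filter_upwards [hinl.eventually hdiff] with x hx using (hpart (x, 0) hx).fderiv
    rw [h1.fderiv_eq]
    have h2 : HasFDerivAt (fun x : E => (x, (0 : E))) (ContinuousLinearMap.inl ℝ E E) 0 :=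
      hasFDerivAt_prodMk_left 0 0
    exact (HasFDerivAt.comp (0 : E) (g := fun p => (fderiv ℝ m p).comp ι)
      (f := fun x : E => (x, (0 : E))) hG.hasFDerivAt h2).fderiv
  rw [hbeta]
  have hid : ∀ᶠ y in 𝓝 (0 : E), (fderiv ℝ m (0, y)).comp ι = ContinuousLinearMap.id ℝ E := by
    filter_upwards [hl.eventually_nhds, hinr.eventually hdiff] with y hy hy'
    have h1 := (hpart (0, y) hy').fderiv
    rw [← h1]
    have h2 : (fun z => m (0, z)) =ᶠ[𝓝 y] fun z => z := hy
    rw [h2.fderiv_eq, fderiv_fun_id]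
  refine isLittleO_iff.2 fun ε hε => ?_
  have hsmall := hG.isLittleO.def hε
  -- Strict differentiability is essential: both points `(x, y)` and `(0, y)` vary, and the error
  -- must be controlled by `‖x‖` alone.
  have hsmall' : ∀ᶠ p : E × E in 𝓝 0, ‖(fderiv ℝ m p).comp ι - (fderiv ℝ m (0, p.2)).comp ι -
      (R.comp D) (p.1, 0)‖ ≤ ε * ‖p.1‖ := by
    have h1 : Tendsto (fun p : E × E => (p, ((0 : E), p.2))) (𝓝 0) (𝓝 (0, 0)) :=
      (by fun_prop : Continuous fun p : E × E => (p, ((0 : E), p.2))).tendsto' _ _ rfl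
    filter_upwards [h1.eventually hsmall] with p hp
    have h2 : p - (0, p.2) = (p.1, 0) := by ext <;> simp
    simp only [h2] at hp
    simpa using hp
  have hall : ∀ᶠ p : E × E in 𝓝 0, ∀ y ∈ Metric.closedBall (0 : E) ‖p.2‖,
      DifferentiableAt ℝ m (p.1, y) ∧ (fderiv ℝ m (0, y)).comp ι = ContinuousLinearMap.id ℝ E ∧
      ‖(fderiv ℝ m (p.1, y)).comp ι - (fderiv ℝ m (0, y)).comp ι - (R.comp D) (p.1, 0)‖ ≤
        ε * ‖p.1‖ := by
    have hsnd : Tendsto (fun p : E × E => p.2) (𝓝 0) (𝓝 0) := continuous_snd.tendsto' _ _ rfl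
    obtain ⟨r, hr, hrs⟩ := Metric.nhds_basis_ball.mem_iff.1
      (hdiff.and ((hsnd.eventually hid).and hsmall'))
    filter_upwards [Metric.ball_mem_nhds (0 : E × E) hr] with p hp y hy
    rw [mem_ball_zero_iff, Prod.norm_def, max_lt_iff] at hp
    rw [mem_closedBall_zero_iff] at hy
    exact hrs (show (p.1, y) ∈ Metric.ball (0 : E × E) r by
      rw [mem_ball_zero_iff, Prod.norm_def]
      exact max_lt hp.1 (hy.trans_lt hp.2))
  have hfst : Tendsto (fun p : E × E => p.1) (𝓝 0) (𝓝 0) := continuous_fst.tendsto' _ _ rfl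
  filter_upwards [hall, hfst.eventually hr] with p hp hp0
  -- Mean value inequality in `y` with `x` fixed: the remainder vanishes at `y = 0` and its
  -- derivative is at most `ε * ‖x‖`, which gives the product `‖x‖ * ‖y‖`.
  have := (convex_closedBall (0 : E) ‖p.2‖).norm_image_sub_le_of_norm_hasFDerivWithin_le
    (f := fun y => m (p.1, y) - p.1 - y - (R.comp D) (p.1, 0) y)
    (f' := fun y => (fderiv ℝ m (p.1, y)).comp ι - ContinuousLinearMap.id ℝ E -
      (R.comp D) (p.1, 0))
    (C := ε * ‖p.1‖) (x := 0) (y := p.2) ?_ ?_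
    (Metric.mem_closedBall_self (norm_nonneg _)) (by simp)
  · simpa [hp0, mul_assoc] using this
  · intro y hy
    exact (((hpart (p.1, y) (hp y hy).1).sub_const _).sub (hasFDerivAt_id y)).sub
      ((R.comp D) (p.1, 0)).hasFDerivAt |>.hasFDerivWithinAt
  · intro y hy
    have h1 := (hp y hy).2.2
    rwa [(hp y hy).2.1] at h1

end Analysis

/-! ### The group law in coordinates centred at the identity -/

section LieGroupCoordinates

variable {E : Type*} [NormedAddCommGroup E] [NormedSpace ℝ E]
  {H : Type*} [TopologicalSpace H] (I : ModelWithCorners ℝ E H)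
  {G : Type*} [TopologicalSpace G] [ChartedSpace H G] [Group G]

/-- The preferred chart of a Lie group at `1`, translated so that `1` has coordinate `0`. -/
noncomputable def lieCoord (g : G) : E := extChartAt I (1 : G) g - extChartAt I (1 : G) 1

/-- The inverse of the coordinate `lieCoord`. -/
noncomputable def lieCoordSymm (x : E) : G :=
  (extChartAt I (1 : G)).symm (x + extChartAt I (1 : G) 1)

variable (G) in
/-- The group law in the coordinates `lieCoord`. -/
noncomputable def lieCoordMul (p : E × E) : E :=
  lieCoord I (lieCoordSymm I p.1 * lieCoordSymm I p.2 : G)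

variable (G) in
/-- The derivative of `y ↦ x * y` at the identity, in the coordinates `lieCoord`. -/
noncomputable def lieCoordFrame (x : E) : E →L[ℝ] E :=
  fderiv ℝ (fun y => lieCoordMul I G (x, y)) 0

variable (G) in
/-- The mixed second derivative of the group law at the identity. -/
noncomputable def lieCoordForm : E →L[ℝ] E →L[ℝ] E := fderiv ℝ (lieCoordFrame I G) 0

@[simp] lemma lieCoord_one : lieCoord I (1 : G) = 0 := sub_self _

@[simp] lemma lieCoordSymm_zero : lieCoordSymm I (0 : E) = (1 : G) := by
  simp [lieCoordSymm]

lemma lieCoordSymm_lieCoord {g : G} (hg : g ∈ (chartAt H (1 : G)).source) :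
    lieCoordSymm I (lieCoord I g) = g := by
  simp only [lieCoordSymm, lieCoord, sub_add_cancel]
  exact (extChartAt I (1 : G)).left_inv (by rwa [extChartAt_source])

lemma eventually_lieCoordSymm_lieCoord :
    ∀ᶠ g in 𝓝 (1 : G), lieCoordSymm I (lieCoord I g) = g :=
  Filter.Eventually.mono (chart_source_mem_nhds H (1 : G)) fun _ hg => lieCoordSymm_lieCoord I hg

lemma contMDiffAt_lieCoord {n : WithTop ℕ∞} [IsManifold I n G] {g : G}
    (hg : g ∈ (chartAt H (1 : G)).source) : ContMDiffAt I 𝓘(ℝ, E) n (lieCoord I) g :=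
  (contMDiffAt_extChartAt' hg).sub contMDiffAt_const

lemma continuousAt_lieCoord {g : G} (hg : g ∈ (chartAt H (1 : G)).source) :
    ContinuousAt (lieCoord I) g :=
  (continuousAt_extChartAt' (by rwa [extChartAt_source])).sub continuousAt_const

lemma tendsto_lieCoord : Tendsto (lieCoord I) (𝓝 (1 : G)) (𝓝 0) := by
  simpa [ContinuousAt] using continuousAt_lieCoord I (mem_chart_source H (1 : G))

section Boundaryless

variable [I.Boundaryless]

variable (G) in
lemma eventually_add_extChartAt_one_mem_target :
    ∀ᶠ x in 𝓝 (0 : E), x + extChartAt I (1 : G) 1 ∈ (extChartAt I (1 : G)).target := by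
  have : Tendsto (fun x : E => x + extChartAt I (1 : G) 1) (𝓝 0) (𝓝 (extChartAt I (1 : G) 1)) :=
    (by fun_prop : Continuous fun x : E => x + extChartAt I (1 : G) 1).tendsto' _ _ (zero_add _)
  exact this.eventually (extChartAt_target_mem_nhds (I := I) (1 : G))

variable (G) in
lemma eventually_lieCoord_lieCoordSymm :
    ∀ᶠ x in 𝓝 (0 : E), lieCoordSymm I x ∈ (chartAt H (1 : G)).source ∧
      lieCoord I (lieCoordSymm I x : G) = x := by
  filter_upwards [eventually_add_extChartAt_one_mem_target I G] with x hx
  refine ⟨?_, ?_⟩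
  · have := (extChartAt I (1 : G)).map_target hx
    rwa [extChartAt_source] at this
  · rw [lieCoord, lieCoordSymm, (extChartAt I (1 : G)).right_inv hx, add_sub_cancel_right]

variable (G) in
lemma eventually_continuousAt_lieCoordSymm :
    ∀ᶠ x in 𝓝 (0 : E), ContinuousAt (lieCoordSymm I : E → G) x := by
  filter_upwards [eventually_add_extChartAt_one_mem_target I G] with x hx
  have h1 : ContinuousAt (extChartAt I (1 : G)).symm (x + extChartAt I (1 : G) 1) :=
    continuousAt_extChartAt_symm'' hx
  exact ContinuousAt.comp (g := (extChartAt I (1 : G)).symm)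
    (f := fun x => x + extChartAt I (1 : G) 1) h1 (by fun_prop)

variable (G) in
lemma tendsto_lieCoordSymm : Tendsto (lieCoordSymm I) (𝓝 (0 : E)) (𝓝 (1 : G)) := by
  simpa [ContinuousAt] using (eventually_continuousAt_lieCoordSymm I G).self_of_nhds

variable {n : WithTop ℕ∞} [IsManifold I n G]

variable (G) in
lemma eventually_contMDiffAt_lieCoordSymm :
    ∀ᶠ x in 𝓝 (0 : E), ContMDiffAt 𝓘(ℝ, E) I n (lieCoordSymm I : E → G) x := by
  filter_upwards [eventually_add_extChartAt_one_mem_target I G] with x hx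
  have h1 : ContMDiffAt 𝓘(ℝ, E) I n (extChartAt I (1 : G)).symm (x + extChartAt I (1 : G) 1) :=
    (contMDiffOn_extChartAt_symm (1 : G)).contMDiffAt (by
      exact (isOpen_extChartAt_target (1 : G)).mem_nhds hx)
  exact h1.comp x (contMDiffAt_id.add contMDiffAt_const)

end Boundaryless

section LieGroup

variable [I.Boundaryless] {n : WithTop ℕ∞} [LieGroup I n G]

variable (G) in
lemma eventually_contDiffAt_lieCoordMul :
    ∀ᶠ p in 𝓝 (0 : E × E), ContDiffAt ℝ n (lieCoordMul I G) p := by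
  have : IsTopologicalGroup G := topologicalGroup_of_lieGroup I n
  have : IsManifold I n G := inferInstance
  have hfst : Tendsto (fun p : E × E => p.1) (𝓝 0) (𝓝 0) := continuous_fst.tendsto' _ _ rfl
  have hsnd : Tendsto (fun p : E × E => p.2) (𝓝 0) (𝓝 0) := continuous_snd.tendsto' _ _ rfl
  have hmul : Tendsto (fun p : E × E => (lieCoordSymm I p.1 * lieCoordSymm I p.2 : G)) (𝓝 0)
      (𝓝 1) := by
    simpa using ((tendsto_lieCoordSymm I G).comp hfst).mul ((tendsto_lieCoordSymm I G).comp hsnd)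
  have hsm := eventually_contMDiffAt_lieCoordSymm I G (n := n)
  filter_upwards [hfst.eventually hsm, hsnd.eventually hsm,
    hmul.eventually (chart_source_mem_nhds H (1 : G))] with p h1 h2 h3
  have hp : ContMDiffAt 𝓘(ℝ, E × E) I n
      (fun p : E × E => (lieCoordSymm I p.1 * lieCoordSymm I p.2 : G)) p :=
    (h1.comp p contDiffAt_fst.contMDiffAt).mul (h2.comp p contDiffAt_snd.contMDiffAt)
  exact ((contMDiffAt_lieCoord I h3).comp p hp).contDiffAt

variable (G) in
lemma contDiffAt_lieCoordMul : ContDiffAt ℝ n (lieCoordMul I G) 0 :=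
  (eventually_contDiffAt_lieCoordMul I G).self_of_nhds

end LieGroup

section Boundaryless

variable [I.Boundaryless]

variable (G) in
lemma eventually_lieCoordMul_zero_left : ∀ᶠ y in 𝓝 (0 : E), lieCoordMul I G (0, y) = y := by
  filter_upwards [eventually_lieCoord_lieCoordSymm I G] with y hy
  simpa [lieCoordMul] using hy.2

variable (G) in
lemma eventually_lieCoordMul_zero_right : ∀ᶠ x in 𝓝 (0 : E), lieCoordMul I G (x, 0) = x := by
  filter_upwards [eventually_lieCoord_lieCoordSymm I G] with y hy
  simpa [lieCoordMul] using hy.2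

variable (G) in
lemma lieCoordFrame_zero : lieCoordFrame I G 0 = ContinuousLinearMap.id ℝ E := by
  rw [lieCoordFrame, Filter.EventuallyEq.fderiv_eq (eventually_lieCoordMul_zero_left I G),
    fderiv_fun_id]

variable (G) in
lemma contDiffAt_lieCoordFrame {n m : WithTop ℕ∞} [LieGroup I n G] (hmn : m + 1 ≤ n) :
    ContDiffAt ℝ m (lieCoordFrame I G) 0 := by
  have h : ContDiffAt ℝ n (Function.uncurry fun x y => lieCoordMul I G (x, y)) ((0 : E), (0 : E)) :=
    contDiffAt_lieCoordMul I G
  exact ContDiffAt.fderiv h contDiffAt_const hmn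

variable (G) in
lemma contDiffAt_one_lieCoordFrame [LieGroup I ∞ G] : ContDiffAt ℝ 1 (lieCoordFrame I G) 0 :=
  contDiffAt_lieCoordFrame I G (n := ∞) (by rw [one_add_one_eq_two]; exact ENat.LEInfty.out)

variable (G) in
lemma hasStrictFDerivAt_lieCoordFrame [LieGroup I ∞ G] :
    HasStrictFDerivAt (lieCoordFrame I G) (lieCoordForm I G) 0 :=
  (contDiffAt_one_lieCoordFrame I G).hasStrictFDerivAt (by simp)

/-- Near `1`, the group law is `x + y + b (x, y) + o (‖x‖ ‖y‖)` for `b = lieCoordForm`. -/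
lemma isLittleO_lieCoord_mul [LieGroup I ∞ G] :
    (fun p : G × G => lieCoord I (p.1 * p.2) - lieCoord I p.1 - lieCoord I p.2 -
        lieCoordForm I G (lieCoord I p.1) (lieCoord I p.2))
      =o[𝓝 1] fun p => ‖lieCoord I p.1‖ * ‖lieCoord I p.2‖ := by
  have h1 := isLittleO_local_mul ((contDiffAt_lieCoordMul I G (n := ∞)).of_le
    ENat.LEInfty.out) (eventually_lieCoordMul_zero_left I G)
    (eventually_lieCoordMul_zero_right I G)
  have h2 : Tendsto (fun p : G × G => (lieCoord I p.1, lieCoord I p.2)) (𝓝 1) (𝓝 0) := by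
    rw [show (1 : G × G) = (1, 1) from rfl, nhds_prod_eq]
    exact ((tendsto_lieCoord I).comp tendsto_fst).prodMk_nhds
      ((tendsto_lieCoord I).comp tendsto_snd)
  refine (h1.comp_tendsto h2).congr' ?_ (Eventually.of_forall fun _ => rfl)
  have h3 : ∀ᶠ p : G × G in 𝓝 1, lieCoordSymm I (lieCoord I p.1) = p.1 ∧
      lieCoordSymm I (lieCoord I p.2) = p.2 := by
    rw [show (1 : G × G) = (1, 1) from rfl, nhds_prod_eq]
    exact (eventually_lieCoordSymm_lieCoord I).prod_mk (eventually_lieCoordSymm_lieCoord I)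
  filter_upwards [h3] with p hp
  simp only [Function.comp_def, lieCoordMul, hp.1, hp.2]
  rfl

end Boundaryless

end LieGroupCoordinates

/-! ### Integral curves of left-invariant fields -/

section InvariantCurves

variable {E : Type*} [NormedAddCommGroup E] [NormedSpace ℝ E]
  {H : Type*} [TopologicalSpace H] {I : ModelWithCorners ℝ E H}
  {G : Type*} [TopologicalSpace G] [ChartedSpace H G] [Group G]

lemma ContinuousLinearMap.comp_one_smulRight {E F : Type*} [NormedAddCommGroup E]
    [NormedSpace ℝ E] [NormedAddCommGroup F] [NormedSpace ℝ F] (A : E →L[ℝ] F) (v : E) :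
    A.comp ((1 : ℝ →L[ℝ] ℝ).smulRight v) = (1 : ℝ →L[ℝ] ℝ).smulRight (A v) := by
  ext; simp

variable (I G) in
-- Charts give T1, and a T1 topological group is Hausdorff. This is needed for uniqueness of
-- integral curves.
lemma t2Space_of_lieGroup {n : WithTop ℕ∞} [LieGroup I n G] : T2Space G := by
  have : IsTopologicalGroup G := topologicalGroup_of_lieGroup I n
  have : T1Space G := I.t1Space G
  infer_instance

variable (I G) in
lemma hasMFDerivAt_lieCoordSymm_zero [I.Boundaryless] {n : WithTop ℕ∞} (hn : n ≠ 0)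
    [IsManifold I n G] :
    HasMFDerivAt 𝓘(ℝ, E) I (lieCoordSymm I : E → G) 0 (ContinuousLinearMap.id ℝ E) := by
  have : IsManifold I 1 G := .of_le (n := n) (ENat.one_le_iff_ne_zero_withTop.2 hn)
  have h1 := mfderivWithin_range_extChartAt_symm (I := I) (x := (1 : G))
  have h2 : MDifferentiableAt 𝓘(ℝ, E) I (extChartAt I (1 : G)).symm (extChartAt I (1 : G) 1) := by
    have := mdifferentiableWithinAt_extChartAt_symm (I := I) (mem_extChartAt_target (I := I) (1 : G))
    rwa [I.range_eq_univ, mdifferentiableWithinAt_univ] at this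
  rw [I.range_eq_univ, mfderivWithin_univ] at h1
  have h3 := h2.hasMFDerivAt
  rw [h1] at h3
  have h4 : HasMFDerivAt 𝓘(ℝ, E) 𝓘(ℝ, E) (fun x : E => x + extChartAt I (1 : G) 1) 0
      (ContinuousLinearMap.id ℝ E) :=
    ((hasFDerivAt_id (0 : E)).add_const _).hasMFDerivAt
  have h5 : ∀ y, y = extChartAt I (1 : G) 1 →
      HasMFDerivAt 𝓘(ℝ, E) I (extChartAt I (1 : G)).symm y (ContinuousLinearMap.id ℝ E) := by
    rintro _ rfl
    exact h3
  exact (h5 _ (zero_add _)).comp 0 h4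

variable [LieGroup I ∞ G]

lemma contMDiff_one_mulInvariantVectorField (u : GroupLieAlgebra I G) :
    ContMDiff I I.tangent 1
      (fun g : G => (⟨g, mulInvariantVectorField u g⟩ : TangentBundle I G)) := by
  refine (contMDiff_mulInvariantVectorField u).of_le ?_
  rw [minSmoothness_of_isRCLikeNormedField]
  norm_num

/-- Left translations preserve left-invariant fields, by the chain rule for `x ↦ g * (γ t * x)`. -/
lemma IsMIntegralCurveOn.const_mul {γ : ℝ → G} {u : GroupLieAlgebra I G} {s : Set ℝ}
    (hγ : IsMIntegralCurveOn γ (mulInvariantVectorField (I := I) u) s) (g : G) :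
    IsMIntegralCurveOn (fun t => g * γ t) (mulInvariantVectorField (I := I) u) s := by
  intro t ht
  have hd : ∀ a b : G, HasMFDerivAt I I (a * ·) b (mfderiv I I (a * ·) b) := fun a b =>
    ((contMDiff_mul_left (I := I) (n := ∞) (a := a)).mdifferentiable (by simp) b).hasMFDerivAt
  have h1 := (hd g (γ t)).comp_hasMFDerivWithinAt t (hγ t ht)
  have h2 : mfderiv I I (g * ·) (γ t) (mulInvariantVectorField u (γ t)) =
      mulInvariantVectorField u (g * γ t) := by
    have h3 : HasMFDerivAt I I (g * ·) (γ t * 1) (mfderiv I I (g * ·) (γ t)) := by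
      rw [mul_one]; exact hd g (γ t)
    have h4 := (h3.comp 1 (hd (γ t) 1)).mfderiv
    have h5 : (fun x => g * x) ∘ (fun x => γ t * x) = fun x => g * γ t * x := by
      ext; simp [mul_assoc]
    rw [h5] at h4
    simp only [mulInvariantVectorField]
    rw [h4]
    rfl
  have h3 : (mfderiv I I (g * ·) (γ t)).comp
      ((1 : ℝ →L[ℝ] ℝ).smulRight (mulInvariantVectorField u (γ t))) =
      (1 : ℝ →L[ℝ] ℝ).smulRight (mulInvariantVectorField u (g * γ t)) := by
    rw [← h2]
    exact ContinuousLinearMap.comp_one_smulRight (E := E) (F := E) _ _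
  exact h3 ▸ h1

variable [I.Boundaryless]

/-- Left-invariant vector fields in the coordinates `lieCoord`. -/
lemma mfderiv_lieCoord_mulInvariantVectorField {g : G} (hg : g ∈ (chartAt H (1 : G)).source)
    (u : GroupLieAlgebra I G) :
    mfderiv I 𝓘(ℝ, E) (lieCoord I) g (mulInvariantVectorField u g) =
      lieCoordFrame I G (lieCoord I g) u := by
  have h1 := hasMFDerivAt_lieCoordSymm_zero I G (n := ∞) (by simp)
  have h2 : HasMFDerivAt I I (g * ·) (lieCoordSymm I (0 : E)) (mfderiv I I (g * ·) (1 : G)) := by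
    rw [lieCoordSymm_zero]
    exact ((contMDiff_mul_left (I := I) (n := ∞) (a := g)).mdifferentiable (by simp) 1).hasMFDerivAt
  have h3 : HasMFDerivAt I 𝓘(ℝ, E) (lieCoord I) (g * lieCoordSymm I (0 : E))
      (mfderiv I 𝓘(ℝ, E) (lieCoord I) g) := by
    rw [lieCoordSymm_zero, mul_one]
    exact ((contMDiffAt_lieCoord I (n := ∞) hg).mdifferentiableAt (by simp)).hasMFDerivAt
  let A : E →L[ℝ] E := mfderiv I 𝓘(ℝ, E) (lieCoord I) g
  let B : E →L[ℝ] E := mfderiv I I (g * ·) (1 : G)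
  have h4 : HasFDerivAt (fun y : E => lieCoord I (g * lieCoordSymm I y)) (A.comp B) 0 :=
    HasMFDerivAt.hasFDerivAt (h3.comp 0 (h2.comp 0 h1))
  have h5 : lieCoordFrame I G (lieCoord I g) = A.comp B := by
    rw [lieCoordFrame]
    simp only [lieCoordMul, lieCoordSymm_lieCoord I hg]
    exact h4.fderiv
  rw [h5]
  rfl

lemma IsMIntegralCurve.hasDerivAt_lieCoord {γ : ℝ → G} {u : GroupLieAlgebra I G}
    (hγ : IsMIntegralCurve γ (mulInvariantVectorField (I := I) u)) {t : ℝ}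
    (ht : γ t ∈ (chartAt H (1 : G)).source) :
    HasDerivAt (fun s => lieCoord I (γ s)) (lieCoordFrame I G (lieCoord I (γ t)) u) t := by
  have h1 := ((contMDiffAt_lieCoord I (n := ∞) ht).mdifferentiableAt (by simp)).hasMFDerivAt
  let A : E →L[ℝ] E := mfderiv I 𝓘(ℝ, E) (lieCoord I) (γ t)
  let v : E := mulInvariantVectorField u (γ t)
  have h2 : HasFDerivAt (fun s => lieCoord I (γ s)) (A.comp ((1 : ℝ →L[ℝ] ℝ).smulRight v)) t :=
    HasMFDerivAt.hasFDerivAt (h1.comp t (hγ t))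
  have h3 : A v = lieCoordFrame I G (lieCoord I (γ t)) u :=
    mfderiv_lieCoord_mulInvariantVectorField ht u
  rw [ContinuousLinearMap.comp_one_smulRight, h3] at h2
  simpa using h2.hasDerivAt

/-- Translating one local curve through `1` gives curves through every point with the same lifetime
`ε`, and a uniform lifetime forces completeness. -/
lemma exists_isMIntegralCurve_mulInvariantVectorField [CompleteSpace E]
    (u : GroupLieAlgebra I G) :
    ∃ γ : ℝ → G, γ 0 = 1 ∧ IsMIntegralCurve γ (mulInvariantVectorField (I := I) u) := by
  have := t2Space_of_lieGroup I G (n := ∞)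
  have hv := contMDiff_one_mulInvariantVectorField u
  obtain ⟨γ, h0, hγ⟩ := exists_isMIntegralCurveAt_of_contMDiffAt_boundaryless 0 (hv (1 : G))
  obtain ⟨ε, hε, hγ⟩ := isMIntegralCurveAt_iff'.1 hγ
  refine exists_isMIntegralCurve_of_isMIntegralCurveOn hv hε (fun g => ?_) 1
  refine ⟨fun t => g * γ t, by simp [h0], ?_⟩
  have := IsMIntegralCurveOn.const_mul hγ g
  rwa [Real.ball_eq_Ioo, zero_sub, zero_add] at this

/-- As functions of `t`, both sides are integral curves of the same field that agree at `t = 0`. -/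
lemma IsMIntegralCurve.map_add_of_mulInvariant [CompleteSpace E] {γ : ℝ → G}
    {u : GroupLieAlgebra I G}
    (hγ : IsMIntegralCurve γ (mulInvariantVectorField (I := I) u)) (h0 : γ 0 = 1) (s t : ℝ) :
    γ (s + t) = γ s * γ t := by
  have := t2Space_of_lieGroup I G (n := ∞)
  have h1 := hγ.comp_add s
  have h2 : IsMIntegralCurve (fun t => γ s * γ t) (mulInvariantVectorField (I := I) u) := by
    rw [isMIntegralCurve_iff_isMIntegralCurveOn] at hγ ⊢
    exact IsMIntegralCurveOn.const_mul hγ (γ s)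
  have h3 := isMIntegralCurve_Ioo_eq_of_contMDiff_boundaryless (t₀ := 0)
    (contMDiff_one_mulInvariantVectorField u) h1 h2 (by simp [h0])
  have := congrFun h3 t
  simpa [add_comm] using this

/-- Smoothness near `0` is regularity for the differential equation in coordinates; the homomorphism
property carries it to every time. -/
lemma IsMIntegralCurve.isOneParameterSubgroup [CompleteSpace E] {γ : ℝ → G}
    {u : GroupLieAlgebra I G}
    (hγ : IsMIntegralCurve γ (mulInvariantVectorField (I := I) u)) (h0 : γ 0 = 1) :
    IsOneParameterSubgroup I γ := by
  have hadd := hγ.map_add_of_mulInvariant h0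
  refine ⟨?_, hadd⟩
  have hcont : Tendsto γ (𝓝 0) (𝓝 1) := 
    hγ.continuous.tendsto' _ _ h0
  have hzero : ContMDiffAt 𝓘(ℝ, ℝ) I ∞ γ 0 := by
    rw [contMDiffAt_infty]
    -- A finite order is fixed because being `C^n` at a point then extends to a neighbourhood.
    intro n
    have hV : ContDiffAt ℝ n (lieCoordFrame I G) 0 :=
      contDiffAt_lieCoordFrame I G (n := ∞) (by exact_mod_cast le_top)
    have hx : Tendsto (fun t => lieCoord I (γ t)) (𝓝 0) (𝓝 0) := (tendsto_lieCoord I).comp hcont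
    obtain ⟨ε, hε, hεs⟩ := Metric.nhds_basis_closedBall.mem_iff.1
      ((hx.eventually (hV.eventually (by simp))).and
        (hcont.eventually (chart_source_mem_nhds H (1 : G))))
    rw [Real.closedBall_eq_Icc, zero_sub, zero_add] at hεs
    have h1 : ContDiffOn ℝ (n : ℕ∞) (fun t => lieCoord I (γ t)) (Icc (-ε) ε) := by
      refine ODE.contDiffOn_enat_Icc_of_hasDerivWithinAt (f := fun _ x => lieCoordFrame I G x u)
        (u := {x | ContDiffAt ℝ n (lieCoordFrame I G) x}) ?_ ?_ ?_
      · rintro ⟨t, x⟩ ⟨-, hx⟩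
        have : ContDiffAt ℝ n (fun p : ℝ × E => lieCoordFrame I G p.2) (t, x) :=
          ContDiffAt.comp (t, x) (g := lieCoordFrame I G) hx contDiffAt_snd
        exact (this.clm_apply contDiffAt_const).contDiffWithinAt
      · exact fun t ht => (hγ.hasDerivAt_lieCoord (hεs ht).2).hasDerivWithinAt
      · exact fun t ht => (hεs ht).1
    have h2 : ContDiffAt ℝ n (fun t => lieCoord I (γ t)) 0 :=
      h1.contDiffAt (Icc_mem_nhds (by linarith) hε)
    have h3 : ContMDiffAt 𝓘(ℝ, E) I n (lieCoordSymm I : E → G) (lieCoord I (γ 0)) := by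
      rw [h0, lieCoord_one]
      exact ((eventually_contMDiffAt_lieCoordSymm I G (n := ∞)).self_of_nhds).of_le
        (by exact_mod_cast le_top)
    refine (h3.comp 0 h2.contMDiffAt).congr_of_eventuallyEq ?_
    filter_upwards [hcont.eventually (eventually_lieCoordSymm_lieCoord I)] with t ht
    exact ht.symm
  intro t
  have h1 : γ = (fun x => γ t * x) ∘ γ ∘ fun s => s - t := by
    ext s
    simp [← hadd]
  rw [h1]
  refine (contMDiff_mul_left (I := I) (n := ∞) (a := γ t)).contMDiffAt.comp t ?_
  refine ContMDiffAt.comp t (by simpa using hzero) ?_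
  exact (contDiffAt_id.sub contDiffAt_const).contMDiffAt

end InvariantCurves

/-! ### The bracket and the exponential map to second order -/

section LieBracketAndExp

variable {E : Type*} [NormedAddCommGroup E] [NormedSpace ℝ E]
  {H : Type*} [TopologicalSpace H] {I : ModelWithCorners ℝ E H} [I.Boundaryless]
  {G : Type*} [TopologicalSpace G] [ChartedSpace H G] [Group G] [LieGroup I ∞ G]

open VectorField in
/-- A left-invariant vector field read in the preferred chart at `1`. -/
lemma mpullbackWithin_mulInvariantVectorField_extChartAt_symm {x : E}
    (hx : x ∈ (extChartAt I (1 : G)).target) (u : GroupLieAlgebra I G) :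
    mpullbackWithin 𝓘(ℝ, E) I (extChartAt I (1 : G)).symm (mulInvariantVectorField u) (range I) x =
      lieCoordFrame I G (x - extChartAt I (1 : G) 1) u := by
  have : IsManifold I 1 G := .of_le (n := ∞) (by simp)
  have hg : (extChartAt I (1 : G)).symm x ∈ (chartAt H (1 : G)).source := by
    have := (extChartAt I (1 : G)).map_target hx
    rwa [extChartAt_source] at this
  have h1 := mfderiv_lieCoord_mulInvariantVectorField hg u
  have h2 : lieCoord I ((extChartAt I (1 : G)).symm x) = x - extChartAt I (1 : G) 1 := by
    rw [lieCoord, (extChartAt I (1 : G)).right_inv hx]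
  rw [h2] at h1
  have h3 : mfderiv I 𝓘(ℝ, E) (lieCoord I) ((extChartAt I (1 : G)).symm x) =
      mfderiv I 𝓘(ℝ, E) (extChartAt I (1 : G)) ((extChartAt I (1 : G)).symm x) := by
    have h4 := (mdifferentiableAt_extChartAt (I := I) hg).hasMFDerivAt
    have h5 := h4.sub (hasMFDerivAt_const (extChartAt I (1 : G) 1) _)
    exact h5.mfderiv.trans (sub_zero _)
  rw [mpullbackWithin_apply, ContinuousLinearMap.inverse_eq
    (mfderivWithin_extChartAt_symm_comp_mfderiv_extChartAt hx)
    (mfderiv_extChartAt_comp_mfderivWithin_extChartAt_symm hx), ← h3]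
  exact h1

/-- The Lie bracket is the antisymmetrisation of the second order term of the group law. -/
lemma GroupLieAlgebra.bracket_eq_lieCoordForm (u v : GroupLieAlgebra I G) :
    ⁅u, v⁆ = (lieCoordForm I G u v - lieCoordForm I G v u : E) := by
  have : IsManifold I 1 G := .of_le (n := ∞) (by simp)
  have hV : ∀ w : E, HasFDerivAt (fun x => lieCoordFrame I G (x - extChartAt I (1 : G) 1) w)
      ((lieCoordForm I G).flip w) (extChartAt I (1 : G) 1) := fun w => by
    have h1 : HasFDerivAt (lieCoordFrame I G) (lieCoordForm I G)
        (extChartAt I (1 : G) 1 - extChartAt I (1 : G) 1) := by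
      rw [sub_self]
      exact (hasStrictFDerivAt_lieCoordFrame I G).hasFDerivAt
    have h2 := (HasFDerivAt.comp (extChartAt I (1 : G) 1)
      (f := fun x => x - extChartAt I (1 : G) 1) h1
      ((hasFDerivAt_id (extChartAt I (1 : G) 1)).sub_const (extChartAt I (1 : G) 1))).clm_apply
      (hasFDerivAt_const w _)
    convert! h2 using 1
    ext
    simp
  have hev : ∀ w : GroupLieAlgebra I G,
      VectorField.mpullbackWithin 𝓘(ℝ, E) I (extChartAt I (1 : G)).symm
        (mulInvariantVectorField w) (range I) =ᶠ[𝓝 (extChartAt I (1 : G) 1)]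
      fun x => lieCoordFrame I G (x - extChartAt I (1 : G) 1) w := fun w => by
    filter_upwards [extChartAt_target_mem_nhds (I := I) (1 : G)] with x hx
    exact mpullbackWithin_mulInvariantVectorField_extChartAt_symm hx w
  have hinv : (mfderiv I 𝓘(ℝ, E) (extChartAt I (1 : G)) (1 : G)).inverse =
      ContinuousLinearMap.id ℝ E := by
    rw [mfderiv_extChartAt_self]
    exact ContinuousLinearMap.inverse_id
  rw [GroupLieAlgebra.bracket_def, VectorField.mlieBracket, VectorField.mlieBracketWithin_apply,
    hinv, preimage_univ, univ_inter]
  have h3 := (hev u).lieBracket_vectorField (𝕜 := ℝ) (hev v)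
  have h4 : ∀ V W : E → E, VectorField.lieBracketWithin ℝ V W (range I) =
      VectorField.lieBracket ℝ V W := fun V W => by
    rw [I.range_eq_univ, VectorField.lieBracketWithin_univ]
  -- The frame is the identity at the base point, so the bracket there is the derivative of the
  -- second field along `a` minus that of the first along `b`.
  have h5 : ∀ a b : E, VectorField.lieBracket ℝ
      (fun x => lieCoordFrame I G (x - extChartAt I (1 : G) 1) a)
      (fun x => lieCoordFrame I G (x - extChartAt I (1 : G) 1) b) (extChartAt I (1 : G) 1) =
      lieCoordForm I G a b - lieCoordForm I G b a := fun a b => by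
    simp [VectorField.lieBracket_eq, (hV _).fderiv, lieCoordFrame_zero, -extChartAt]
  refine (congrFun (h4 _ _) _).trans (h3.self_of_nhds.trans (h5 u v))

variable [FiniteDimensional ℝ E]

variable (I G) in
/-- Left-invariant curves stay in the preferred chart for a uniform time. -/
lemma eventually_isMIntegralCurve_mem_chart :
    ∀ᶠ u : E in 𝓝 0, ∀ γ : ℝ → G, γ 0 = 1 →
      IsMIntegralCurve γ (mulInvariantVectorField (I := I) (G := G) u) →
      ∀ t ∈ Icc (0 : ℝ) 1, γ t ∈ (chartAt H (1 : G)).source ∧ ‖lieCoord I (γ t)‖ ≤ 2 * ‖u‖ := by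
  have := t2Space_of_lieGroup I G (n := ∞)
  have : ProperSpace E := FiniteDimensional.proper_real E
  have hframe : ∀ᶠ x in 𝓝 (0 : E), ‖lieCoordFrame I G x‖ ≤ 2 := by
    have h1 : ContinuousAt (fun x => ‖lieCoordFrame I G x‖) 0 :=
      (contDiffAt_one_lieCoordFrame I G).continuousAt.norm
    have h2 : ‖lieCoordFrame I G 0‖ < 2 := by
      rw [lieCoordFrame_zero]
      exact ContinuousLinearMap.norm_id_le.trans_lt one_lt_two
    exact (h1.tendsto.eventually_lt_const h2).mono fun _ h => h.le
  obtain ⟨r, hr, hrs⟩ := Metric.nhds_basis_closedBall.mem_iff.1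
    (hframe.and ((eventually_lieCoord_lieCoordSymm I G).and
      (eventually_continuousAt_lieCoordSymm I G)))
  -- Two nested sets for an exit-time argument: `U` is open, so there is a first exit time, and `K`
  -- is closed, so the curve is still controlled at that time.
  set U : Set G := (chartAt H (1 : G)).source ∩ lieCoord I ⁻¹' Metric.ball 0 r
  set K : Set G := lieCoordSymm I '' Metric.closedBall (0 : E) r
  have hUopen : IsOpen U := by
    refine ContinuousOn.isOpen_inter_preimage (fun g hg => ?_) (chartAt H (1 : G)).open_source
      Metric.isOpen_ball
    exact (continuousAt_lieCoord I hg).continuousWithinAt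
  have hKclosed : IsClosed K := by
    refine ((isCompact_closedBall (0 : E) r).image_of_continuousOn fun x hx => ?_).isClosed
    exact (hrs hx).2.2.continuousWithinAt
  have hUK : U ⊆ K := fun g hg =>
    ⟨lieCoord I g, Metric.ball_subset_closedBall hg.2, lieCoordSymm_lieCoord I hg.1⟩
  have hKprop : ∀ g ∈ K, g ∈ (chartAt H (1 : G)).source ∧ ‖lieCoordFrame I G (lieCoord I g)‖ ≤ 2 := by
    rintro _ ⟨x, hx, rfl⟩
    refine ⟨(hrs hx).2.1.1, ?_⟩
    rw [(hrs hx).2.1.2]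
    exact (hrs hx).1
  filter_upwards [Metric.ball_mem_nhds (0 : E) (half_pos hr)] with u hu γ h0 hγ
  rw [mem_ball_zero_iff] at hu
  have hbound : ∀ τ : ℝ, 0 ≤ τ → (∀ s ∈ Icc 0 τ, γ s ∈ K) → ‖lieCoord I (γ τ)‖ ≤ 2 * ‖u‖ * τ := by
    intro τ hτ hs
    have := norm_image_sub_le_of_norm_deriv_le_segment'
      (f := fun t => lieCoord I (γ t)) (C := 2 * ‖u‖) (a := 0) (b := τ)
      (fun t ht => (hγ.hasDerivAt_lieCoord (hKprop _ (hs t ht)).1).hasDerivWithinAt)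
      (fun t ht => ?_) τ (right_mem_Icc.2 hτ)
    · simpa [h0] using this
    · refine (ContinuousLinearMap.le_opNorm _ _).trans ?_
      have := (hKprop _ (hs t (Ico_subset_Icc_self ht))).2
      exact mul_le_mul_of_nonneg_right this (norm_nonneg (u : E))
  -- At the first exit time `τ ≤ 1` the speed bound gives coordinate norm at most `2 * ‖u‖ < r`, so
  -- the curve would still be in `U`.
  have hUall : ∀ t ∈ Icc (0 : ℝ) 1, γ t ∈ U := by
    by_contra! hcon
    obtain ⟨t₀, ht₀, hnot⟩ := hcon
    set A : Set ℝ := Ici 0 ∩ γ ⁻¹' Uᶜ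
    have hAclosed : IsClosed A := isClosed_Ici.inter (hUopen.isClosed_compl.preimage hγ.continuous)
    have hAbdd : BddBelow A := ⟨0, fun t ht => ht.1⟩
    have hAt₀ : t₀ ∈ A := ⟨ht₀.1, hnot⟩
    have hτ := hAclosed.csInf_mem ⟨t₀, hAt₀⟩ hAbdd
    have hτ1 : sInf A ≤ 1 := (csInf_le hAbdd hAt₀).trans ht₀.2
    set τ := sInf A
    have hbefore : ∀ s ∈ Ico 0 τ, γ s ∈ U := fun s hs => by
      by_contra h
      exact absurd (csInf_le hAbdd (show s ∈ A from ⟨hs.1, h⟩)) (not_le.2 hs.2)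
    have hτ0 : 0 ≠ τ := by
      intro h
      apply hτ.2
      rw [← h, h0]
      exact ⟨mem_chart_source H 1, by simpa using hr⟩
    have hcl : Icc 0 τ ⊆ γ ⁻¹' K := by
      rw [← closure_Ico hτ0]
      exact closure_minimal (fun s hs => hUK (hbefore s hs)) (hKclosed.preimage hγ.continuous)
    refine hτ.2 ⟨(hKprop _ (hcl (right_mem_Icc.2 hτ.1))).1, ?_⟩
    rw [mem_preimage, mem_ball_zero_iff]
    have := hbound τ hτ.1 fun s hs => hcl hs
    have h2 : 2 * ‖u‖ * τ ≤ 2 * ‖u‖ := mul_le_of_le_one_right (by positivity) hτ1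
    linarith
  intro t ht
  refine ⟨(hUall t ht).1, ?_⟩
  have := hbound t ht.1 fun s hs => hUK (hUall s ⟨hs.1, hs.2.trans ht.2⟩)
  exact this.trans (mul_le_of_le_one_right (by positivity) ht.2)

variable (I G) in
/-- The exponential map of a Lie group, with its second order expansion at `0`. -/
theorem exists_lieExp :
    ∃ ex : E → G, (∀ (c : ℝ) (u : E), IsRealPower I c (ex u) (ex (c • u))) ∧
      Tendsto ex (𝓝 0) (𝓝 1) ∧
      HasStrictFDerivAt (fun u => lieCoord I (ex u)) (ContinuousLinearMap.id ℝ E) 0 ∧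
      (fun u => lieCoord I (ex u) - u - (2⁻¹ : ℝ) • lieCoordForm I G u u) =o[𝓝 0]
        fun u => ‖u‖ ^ 2 := by
  have := t2Space_of_lieGroup I G (n := ∞)
  have : CompleteSpace E := FiniteDimensional.complete ℝ E
  choose γ h0 hγ using fun u : E =>
    exists_isMIntegralCurve_mulInvariantVectorField (I := I) (G := G) u
  -- By uniqueness, `t ↦ γ u (c t)` is the curve of `c • u`.
  have hscale : ∀ (c : ℝ) (u : E), γ (c • u) 1 = γ u c := by
    intro c u
    have h1 := (hγ u).comp_mul c
    have h2 : c • mulInvariantVectorField (I := I) (G := G) u =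
        mulInvariantVectorField (I := I) (G := G) (c • u : E) :=
      (mulInvariantVectorField_smul (I := I) (G := G) c u).symm
    rw [h2] at h1
    have h3 := isMIntegralCurve_Ioo_eq_of_contMDiff_boundaryless (t₀ := 0)
      (contMDiff_one_mulInvariantVectorField (I := I) (G := G) (c • u : E)) (hγ (c • u)) h1
      (by simp [h0])
    simpa using congrFun h3 1
  have hchart := eventually_isMIntegralCurve_mem_chart I G
  have hx : ∀ᶠ u in 𝓝 (0 : E), ∀ t ∈ Icc (0 : ℝ) 1,
      HasDerivAt (fun t => lieCoord I (γ u t)) (lieCoordFrame I G (lieCoord I (γ u t)) u) t ∧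
        ‖lieCoord I (γ u t)‖ ≤ 2 * ‖u‖ := by
    filter_upwards [hchart] with u hu t ht
    have := hu (γ u) (h0 u) (hγ u) t ht
    exact ⟨(hγ u).hasDerivAt_lieCoord this.1, this.2⟩
  have hV := hasStrictFDerivAt_lieCoordFrame I G
  have hstrict := hasStrictFDerivAt_ode_endpoint hV (lieCoordFrame_zero I G)
    (x := fun u t => lieCoord I (γ u t)) (by simp [h0]) hx
  refine ⟨fun u => γ u 1, fun c u => Or.inl ⟨γ u, (hγ u).isOneParameterSubgroup (h0 u), rfl,
    (hscale c u).symm⟩, ?_, hstrict, ?_⟩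
  · have h1 : Tendsto (fun u => lieCoord I (γ u 1)) (𝓝 0) (𝓝 0) := by
      have := hstrict.continuousAt.tendsto
      have h2 : γ 0 1 = 1 := by simpa [h0] using hscale 0 0
      simpa [h2] using this
    refine ((tendsto_lieCoordSymm I G).comp h1).congr' ?_
    filter_upwards [hchart] with u hu
    exact lieCoordSymm_lieCoord I (hu (γ u) (h0 u) (hγ u) 1 (right_mem_Icc.2 zero_le_one)).1
  · exact isLittleO_ode_endpoint hV (lieCoordFrame_zero I G)
      (x := fun u t => lieCoord I (γ u t)) (by simp [h0]) hx

end LieBracketAndExp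

/-! ### Calculus of two-jets of curves -/

section TwoJets

variable {E : Type*} [NormedAddCommGroup E] [NormedSpace ℝ E]
  {F : Type*} [NormedAddCommGroup F] [NormedSpace ℝ F]

/-- The curve `κ` has the expansion `κ ε = ε a + ε ^ 2 b + o (ε ^ 2)` at `0`. -/
def HasTwoJet (κ : ℝ → E) (a b : E) : Prop :=
  (fun ε => κ ε - ε • a - ε ^ 2 • b) =o[𝓝 0] fun ε => ε ^ 2

lemma eq_zero_of_pow_smul_isLittleO {n : ℕ} {a : E}
    (h : (fun ε : ℝ => ε ^ n • a) =o[𝓝 0] fun ε => ε ^ n) : a = 0 := by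
  rw [← norm_le_zero_iff]
  refine le_of_forall_pos_le_add fun c hc => ?_
  have h1 := (h.def hc).filter_mono (nhdsWithin_le_nhds (s := {0}ᶜ))
  obtain ⟨ε, hε, hε0⟩ := (h1.and self_mem_nhdsWithin).exists
  have hpos : 0 < ‖ε ^ n‖ := norm_pos_iff.2 (pow_ne_zero n hε0)
  rw [norm_smul, mul_comm] at hε
  rw [zero_add]
  exact le_of_mul_le_mul_right hε hpos

lemma isBigO_smul_const {l : Filter ℝ} (g : ℝ → ℝ) (a : E) : (fun ε => g ε • a) =O[l] g :=
  IsBigO.of_bound ‖a‖ (Eventually.of_forall fun ε => by rw [norm_smul, mul_comm])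

lemma sq_isLittleO_id : (fun ε : ℝ => ε ^ 2) =o[𝓝 0] fun ε => ε := by
  simpa using isLittleO_pow_pow (𝕜 := ℝ) (one_lt_two)

namespace HasTwoJet

variable {κ μ : ℝ → E} {a b c d : E}

/-- Since `ε ^ 2` is `o(ε)`, the first coefficients agree; cancelling them isolates the second ones.
-/
lemma unique (h : HasTwoJet κ a b) (h' : HasTwoJet κ c d) : a = c ∧ b = d := by
  have h1 : (fun ε : ℝ => ε • (a - c) + ε ^ 2 • (b - d)) =o[𝓝 0] fun ε => ε ^ 2 :=
    (IsLittleO.sub h' h).congr_left fun ε => by module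
  have h2 : (fun ε : ℝ => ε ^ 2 • (b - d)) =O[𝓝 0] fun ε => ε ^ 2 := isBigO_smul_const _ _
  have h3 : (fun ε : ℝ => ε ^ 1 • (a - c)) =o[𝓝 0] fun ε => ε ^ 1 := by
    have := (h1.trans sq_isLittleO_id).sub (h2.trans_isLittleO sq_isLittleO_id)
    simpa using this
  have hac := sub_eq_zero.1 (eq_zero_of_pow_smul_isLittleO h3)
  subst hac
  refine ⟨rfl, sub_eq_zero.1 (eq_zero_of_pow_smul_isLittleO (n := 2) ?_)⟩
  simpa using h1

lemma congr' (h : HasTwoJet κ a b) (hκ : κ =ᶠ[𝓝 0] μ) : HasTwoJet μ a b :=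
  IsLittleO.congr' h (hκ.mono fun ε hε => by simp only [hε]) EventuallyEq.rfl

lemma isBigO_sub (h : HasTwoJet κ a b) : (fun ε => κ ε - ε • a) =O[𝓝 0] fun ε => ε ^ 2 := by
  have h2 : (fun ε : ℝ => ε ^ 2 • b) =O[𝓝 0] fun ε => ε ^ 2 := isBigO_smul_const _ _
  exact (h.isBigO.add h2).congr_left fun ε => by abel

lemma isBigO (h : HasTwoJet κ a b) : κ =O[𝓝 0] fun ε => ε := by
  have h2 : (fun ε : ℝ => ε • a) =O[𝓝 0] fun ε => ε := isBigO_smul_const _ _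
  exact ((h.isBigO_sub.trans sq_isLittleO_id.isBigO).add h2).congr_left fun ε => by abel

lemma tendsto (h : HasTwoJet κ a b) : Tendsto κ (𝓝 0) (𝓝 0) :=
  h.isBigO.trans_tendsto tendsto_id

lemma add (h : HasTwoJet κ a b) (h' : HasTwoJet μ c d) :
    HasTwoJet (fun ε => κ ε + μ ε) (a + c) (b + d) :=
  (IsLittleO.add h h').congr_left fun ε => by module

lemma clm (h : HasTwoJet κ a b) (A : E →L[ℝ] F) : HasTwoJet (fun ε => A (κ ε)) (A a) (A b) :=
  ((A.isBigO_comp _ _).trans_isLittleO h).congr_left fun ε => by simp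

lemma bilinear (h : HasTwoJet κ a b) (h' : HasTwoJet μ c d) (Q : E →L[ℝ] E →L[ℝ] F) :
    HasTwoJet (fun ε => Q (κ ε) (μ ε)) 0 (Q a c) := by
  have hb : ∀ {x y : ℝ → E}, (fun ε => Q (x ε) (y ε)) =O[𝓝 0] fun ε => ‖x ε‖ * ‖y ε‖ :=
    fun {x y} => IsBigO.of_bound ‖Q‖ (Eventually.of_forall fun ε => by
      simpa [mul_assoc] using Q.le_opNorm₂ (x ε) (y ε))
  have hid : (fun ε : ℝ => ε • a) =O[𝓝 0] fun ε => ε := isBigO_smul_const _ _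
  have h3 : (fun ε : ℝ => ε ^ 2 * ε) =o[𝓝 0] fun ε => ε ^ 2 := by
    simpa [pow_succ] using isLittleO_pow_pow (𝕜 := ℝ) (show 2 < 3 by norm_num)
  have h1 : (fun ε => Q (κ ε - ε • a) (μ ε)) =o[𝓝 0] fun ε => ε ^ 2 :=
    (hb.trans (h.isBigO_sub.norm_left.mul h'.isBigO.norm_left)).trans_isLittleO h3
  have h2 : (fun ε => Q (ε • a) (μ ε - ε • c)) =o[𝓝 0] fun ε => ε ^ 2 :=
    (hb.trans ((hid.norm_left.mul h'.isBigO_sub.norm_left).congr_right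
      fun ε => mul_comm _ _)).trans_isLittleO h3
  refine (h1.add h2).congr_left fun ε => ?_
  simp only [map_sub, map_smul, sub_apply, smul_apply]
  module

lemma of_isLittleO (h : κ =o[𝓝 0] fun ε => ε ^ 2) : HasTwoJet κ 0 0 :=
  IsLittleO.congr_left h fun ε => by simp

lemma comp {f : E → F} {A : E →L[ℝ] F} {Q : E →L[ℝ] E →L[ℝ] F} (h : HasTwoJet κ a b)
    (hf : (fun x => f x - A x - Q x x) =o[𝓝 0] fun x => ‖x‖ ^ 2) :
    HasTwoJet (fun ε => f (κ ε)) (A a) (A b + Q a a) := by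
  have h1 : HasTwoJet (fun ε => f (κ ε) - A (κ ε) - Q (κ ε) (κ ε)) 0 0 :=
    of_isLittleO ((hf.comp_tendsto h.tendsto).trans_isBigO (h.isBigO.norm_left.pow 2))
  have h2 := (h1.add (h.clm A)).add (h.bilinear h Q)
  simp only [zero_add, add_zero] at h2
  exact h2.congr' (Eventually.of_forall fun ε => by simp only; abel)

end HasTwoJet

/-- A map tangent to the identity to first order has a local inverse, whose second order term is
the opposite one. -/
lemma exists_localInverse_isLittleO_sq [CompleteSpace E] {f : E → E} {q : E →L[ℝ] E →L[ℝ] E}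
    (hf : HasStrictFDerivAt f (ContinuousLinearMap.id ℝ E) 0)
    (hq : (fun u => f u - u - q u u) =o[𝓝 0] fun u => ‖u‖ ^ 2) :
    ∃ l : E → E, (∀ᶠ x in 𝓝 0, f (l x) = x) ∧
      (fun x => l x - ContinuousLinearMap.id ℝ E x - (-q) x x) =o[𝓝 0] fun x => ‖x‖ ^ 2 := by
  have hf' : HasStrictFDerivAt f ((ContinuousLinearEquiv.refl ℝ E : E ≃L[ℝ] E) : E →L[ℝ] E) 0 := hf
  have h0 : f 0 = 0 := by
    have := (hq.def one_pos).self_of_nhds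
    simpa using this
  set l := hf'.localInverse with hl
  have hl0 : l 0 = 0 := by simpa [h0] using hf'.localInverse_apply_image
  have hright : ∀ᶠ x in 𝓝 0, f (l x) = x := by simpa [h0] using hf'.eventually_right_inverse
  have hld : HasFDerivAt l (ContinuousLinearMap.id ℝ E) 0 := by
    have := hf'.to_localInverse.hasFDerivAt
    rw [h0] at this
    exact this
  refine ⟨l, hright, ?_⟩
  have h1 : (fun x => l x - x) =o[𝓝 0] fun x => ‖x‖ := by
    simpa [hl0] using hld.isLittleO.norm_right
  have h2 : l =O[𝓝 0] fun x => ‖x‖ :=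
    (h1.isBigO.add (isBigO_refl (fun x : E => x) (𝓝 0)).norm_right).congr_left fun x => by abel
  have hlt : Tendsto l (𝓝 0) (𝓝 0) := by simpa [ContinuousAt, hl0] using hld.continuousAt
  -- The expansion of `f` at `l x`; since `l x = x + o(‖x‖)`, `q (l x) (l x)` may then be replaced
  -- by `q x x`.
  have h3 : (fun x => x - l x - q (l x) (l x)) =o[𝓝 0] fun x => ‖x‖ ^ 2 := by
    refine ((hq.comp_tendsto hlt).trans_isBigO (h2.norm_left.pow 2)).congr' ?_ EventuallyEq.rfl
    filter_upwards [hright] with x hx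
    simp [hx]
  have hb : ∀ {x y : E → E}, (fun z => q (x z) (y z)) =O[𝓝 0] fun z => ‖x z‖ * ‖y z‖ :=
    fun {x y} => IsBigO.of_bound ‖q‖ (Eventually.of_forall fun z => by
      simpa [mul_assoc] using q.le_opNorm₂ (x z) (y z))
  have h4 : (fun x => q (l x - x) (l x)) =o[𝓝 0] fun x => ‖x‖ ^ 2 := by
    simp only [pow_two]
    exact hb.trans_isLittleO (h1.norm_left.mul_isBigO h2.norm_left)
  have h5 : (fun x => q x (l x - x)) =o[𝓝 0] fun x => ‖x‖ ^ 2 := by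
    simp only [pow_two]
    exact hb.trans_isLittleO ((isBigO_refl (fun x : E => ‖x‖) (𝓝 0)).mul_isLittleO h1.norm_left)
  refine (((h3.add h4).add h5).neg_left).congr_left fun x => ?_
  simp
  abel

end TwoJets

/-! ### Two-jets of curves in a Lie group -/

section LieTwoJets

variable {E : Type*} [NormedAddCommGroup E] [NormedSpace ℝ E]
  {H : Type*} [TopologicalSpace H] {I : ModelWithCorners ℝ E H}
  {G : Type*} [TopologicalSpace G] [ChartedSpace H G] [Group G]

variable (I) in
/-- The curve `κ` in the Lie group `G` tends to `1` at `0`, and has the expansion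
`ε a + ε ^ 2 b + o (ε ^ 2)` in the coordinates `lieCoord`. -/
def HasLieTwoJet (κ : ℝ → G) (a b : E) : Prop :=
  Tendsto κ (𝓝 0) (𝓝 1) ∧ HasTwoJet (fun ε => lieCoord I (κ ε)) a b

lemma hasMFDerivAt_lieCoord_one [LieGroup I ∞ G] :
    HasMFDerivAt I 𝓘(ℝ, E) (lieCoord I) (1 : G) (ContinuousLinearMap.id ℝ E) := by
  have : IsManifold I 1 G := .of_le (n := ∞) (by simp)
  have h1 := (mdifferentiableAt_extChartAt (I := I) (mem_chart_source H (1 : G))).hasMFDerivAt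
  rw [mfderiv_extChartAt_self] at h1
  have h2 := h1.sub (hasMFDerivAt_const (extChartAt I (1 : G) 1) _)
  have h3 : (ContinuousLinearMap.id ℝ E - 0 : E →L[ℝ] E) = ContinuousLinearMap.id ℝ E := sub_zero _
  exact h3 ▸ h2

variable [I.Boundaryless]

variable (G) in
lemma hasLieTwoJet_lieCoordSymm_smul (u : E) :
    HasLieTwoJet I (fun ε => (lieCoordSymm I (ε • u) : G)) u 0 := by
  have h1 : HasTwoJet (fun ε : ℝ => ε • u) u 0 :=
    (isLittleO_zero (E' := E) (fun ε : ℝ => ε ^ 2) (𝓝 0)).congr_left fun ε => by simp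
  refine ⟨(tendsto_lieCoordSymm I G).comp h1.tendsto, h1.congr' ?_⟩
  filter_upwards [h1.tendsto.eventually (eventually_lieCoord_lieCoordSymm I G)] with ε hε
  exact hε.2.symm

variable [LieGroup I ∞ G]

/-- Both curves are `O(ε)`, so the remainder `o(‖x‖ ‖y‖)` of the group law is `o(ε ^ 2)` and the
bilinear term sees only `a` and `c`. -/
lemma HasLieTwoJet.mul {κ μ : ℝ → G} {a b c d : E} (h : HasLieTwoJet I κ a b)
    (h' : HasLieTwoJet I μ c d) :
    HasLieTwoJet I (fun ε => κ ε * μ ε) (a + c) (b + d + lieCoordForm I G a c) := by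
  have : IsTopologicalGroup G := topologicalGroup_of_lieGroup I ∞
  refine ⟨by simpa using h.1.mul h'.1, ?_⟩
  have h1 : Tendsto (fun ε => (κ ε, μ ε)) (𝓝 0) (𝓝 (1 : G × G)) := h.1.prodMk_nhds h'.1
  have h2 : HasTwoJet _ (0 : E) 0 := HasTwoJet.of_isLittleO
    (((isLittleO_lieCoord_mul I).comp_tendsto h1).trans_isBigO
      ((h.2.isBigO.norm_left.mul h'.2.isBigO.norm_left).congr_right fun ε => (pow_two ε).symm))
  have h3 := h2.add ((h.2.add h'.2).add (h.2.bilinear h'.2 (lieCoordForm I G)))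
  simp only [zero_add, add_zero] at h3
  refine h3.congr' (Eventually.of_forall fun ε => ?_)
  simp only [Function.comp_def]
  abel

/-- The effect on two-jets of a smooth map fixing the identity. -/
lemma exists_hasLieTwoJet_comp {Φ : G → G} (hΦ : ContMDiffAt I I ∞ Φ 1) (h1 : Φ 1 = 1)
    {A : E →L[ℝ] E} (hA : mfderiv I I Φ 1 = A) :
    ∃ Q : E →L[ℝ] E →L[ℝ] E, ∀ (κ : ℝ → G) (a b : E), HasLieTwoJet I κ a b →
      HasLieTwoJet I (fun ε => Φ (κ ε)) (A a) (A b + Q a a) := by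
  set f : E → E := fun x => lieCoord I (Φ (lieCoordSymm I x)) with hf
  have hσ : ContMDiffAt 𝓘(ℝ, E) I ∞ (lieCoordSymm I : E → G) 0 :=
    (eventually_contMDiffAt_lieCoordSymm I G).self_of_nhds
  have hsmooth : ContDiffAt ℝ ∞ f 0 := by
    have h2 : ContMDiffAt I I ∞ Φ (lieCoordSymm I (0 : E)) := by rwa [lieCoordSymm_zero]
    have h3 : ContMDiffAt I 𝓘(ℝ, E) ∞ (lieCoord I) (Φ (lieCoordSymm I (0 : E))) := by
      rw [lieCoordSymm_zero, h1]
      exact contMDiffAt_lieCoord I (mem_chart_source H 1)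
    exact (h3.comp 0 (h2.comp 0 hσ)).contDiffAt
  have hf0 : f 0 = 0 := by simp [hf, h1]
  have hder : fderiv ℝ f 0 = A := by
    have h2 : ∀ g : G, g = 1 → HasMFDerivAt I I Φ g A := by
      rintro _ rfl
      rw [← hA]
      exact (hΦ.mdifferentiableAt (by simp)).hasMFDerivAt
    have h3 : ∀ g : G, g = 1 → HasMFDerivAt I 𝓘(ℝ, E) (lieCoord I) g
        (ContinuousLinearMap.id ℝ E) := by
      rintro _ rfl
      exact hasMFDerivAt_lieCoord_one
    have h4 := (h3 _ (by simp [h1])).comp 0 ((h2 _ (lieCoordSymm_zero I)).comp 0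
      (hasMFDerivAt_lieCoordSymm_zero I G (n := ∞) (by simp)))
    have h5 : HasFDerivAt f A 0 := HasMFDerivAt.hasFDerivAt h4
    exact h5.fderiv
  obtain ⟨Q, hQ⟩ := (hsmooth.of_le ENat.LEInfty.out : ContDiffAt ℝ 2 f 0).exists_isLittleO_sq
  simp only [hf0, sub_zero, hder] at hQ
  refine ⟨Q, fun κ a b hκ => ⟨?_, ?_⟩⟩
  · have := hΦ.continuousAt.tendsto.comp hκ.1
    rwa [h1] at this
  · refine (hκ.2.comp hQ).congr' ?_
    filter_upwards [hκ.1.eventually (eventually_lieCoordSymm_lieCoord I)] with ε hε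
    simp only [hf, hε]

variable [FiniteDimensional ℝ E]

variable (I G) in
/-- The effect on two-jets of the maps which are `u ↦ c u` in exponential coordinates. -/
lemma exists_lieExp_hasLieTwoJet :
    ∃ ex : E → G, (∀ (c : ℝ) (u : E), IsRealPower I c (ex u) (ex (c • u))) ∧
      ∀ (c : ℝ) (Φ : G → G), (∀ u, Φ (ex u) = ex (c • u)) → ∀ (κ : ℝ → G) (a b : E),
        HasLieTwoJet I κ a b → HasLieTwoJet I (fun ε => Φ (κ ε)) (c • a)
          (c • b + ((c ^ 2 - c) / 2) • lieCoordForm I G a a) := by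
  have : CompleteSpace E := FiniteDimensional.complete ℝ E
  obtain ⟨ex, hpow, hex, hstrict, hexp⟩ := exists_lieExp I G
  refine ⟨ex, hpow, fun c Φ hΦ κ a b hκ => ?_⟩
  -- Near `1`, `Φ` is logarithm, scaling by `c`, exponential. The logarithm contributes `-β(a, a) /
  -- 2`, scaled by `c`, and the exponential `c ^ 2 β(a, a) / 2`.
  obtain ⟨l, hl, hlq⟩ := exists_localInverse_isLittleO_sq
    (q := (2⁻¹ : ℝ) • lieCoordForm I G) hstrict (by simpa using hexp)
  have hlog := hκ.2.comp hlq
  have hclog := hlog.clm (c • ContinuousLinearMap.id ℝ E)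
  have hκex : ∀ᶠ ε in 𝓝 0, ex (l (lieCoord I (κ ε))) = κ ε := by
    filter_upwards [hκ.1.eventually (eventually_lieCoordSymm_lieCoord I),
      (hex.comp hlog.tendsto).eventually (eventually_lieCoordSymm_lieCoord I),
      hκ.2.tendsto.eventually hl] with ε h1 h2 h3
    simp only [Function.comp_apply] at h2
    rw [← h2, h3, h1]
  have hΦκ : (fun ε => ex ((c • ContinuousLinearMap.id ℝ E) (l (lieCoord I (κ ε))))) =ᶠ[𝓝 0]
      fun ε => Φ (κ ε) := by
    filter_upwards [hκex] with ε hε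
    rw [← hε, hΦ, hε]
    rfl
  refine ⟨(hex.comp hclog.tendsto).congr' hΦκ, ?_⟩
  have h1 := hclog.comp (f := fun u => lieCoord I (ex u)) (A := ContinuousLinearMap.id ℝ E)
    (Q := (2⁻¹ : ℝ) • lieCoordForm I G) (by simpa using hexp)
  have h2 := h1.congr' (hΦκ.mono fun ε hε => congrArg (lieCoord I) hε)
  convert! h2 using 1
  simp
  module

end LieTwoJets

/-! ### The Rota–Baxter identity to second order -/

section RotaBaxter

variable {E : Type*} [NormedAddCommGroup E] [NormedSpace ℝ E]
  {H : Type*} [TopologicalSpace H] {I : ModelWithCorners ℝ E H}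
  {G : Type*} [TopologicalSpace G] [ChartedSpace H G] [Group G]

lemma IsPowerBijection.map_one {c : ℝ} {f : G ≃ G} (hf : IsPowerBijection I c f) : f 1 = 1 :=
  (hf 1 1).1 (Or.inl ⟨fun _ => 1, ⟨contMDiff_const, fun _ _ => (one_mul 1).symm⟩, rfl, rfl⟩)

/-- Since `f` fixes `1`, the identity at `g = h = 1` makes `𝓑 1` idempotent, hence trivial. -/
lemma IsGroupRotaBaxterOperator.map_one {c : ℝ} {𝓑 : G → G}
    (h𝓑 : IsGroupRotaBaxterOperator I c 𝓑) : 𝓑 1 = 1 := by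
  obtain ⟨f, hf, h⟩ := h𝓑
  have h1 := h 1 1
  rw [mul_one, mul_inv_cancel, transportedMul, hf.map_one, mul_one, ← hf.map_one,
    Equiv.symm_apply_apply, hf.map_one] at h1
  exact mul_eq_left.1 h1

variable [FiniteDimensional ℝ E] [I.Boundaryless] [LieGroup I ∞ G]

/-- The second order term of the Rota–Baxter identity, before antisymmetrisation. -/
lemma IsGroupRotaBaxterOperator.exists_second_order {c : ℝ} (hc : c ≠ 0) {𝓑 : G → G}
    (h𝓑 : IsGroupRotaBaxterOperator I c 𝓑) (hsmooth : ContMDiff I I ∞ 𝓑) {B : E →L[ℝ] E}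
    (hB : mfderiv I I 𝓑 1 = B) :
    ∃ Q : E →L[ℝ] E →L[ℝ] E, ∀ u v : E,
      lieCoordForm I G (B u) (B v) = B (lieCoordForm I G (B u) v - lieCoordForm I G v (B u) +
        c • lieCoordForm I G u v +
        ((1 - c) / 2) • (lieCoordForm I G u v + lieCoordForm I G v u)) + (Q u v + Q v u) := by
  have h1 := h𝓑.map_one
  obtain ⟨f, hf, hRB⟩ := h𝓑
  obtain ⟨Q, hQ⟩ := exists_hasLieTwoJet_comp hsmooth.contMDiffAt h1 hB
  obtain ⟨R, hR⟩ := exists_hasLieTwoJet_comp (I := I) (G := G) (Φ := fun g => g⁻¹)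
    (contMDiff_inv I ∞).contMDiffAt inv_one rfl
  obtain ⟨ex, hpow, hex⟩ := exists_lieExp_hasLieTwoJet I G
  have hfex : ∀ u, f (ex u) = ex (c • u) := fun u => (hf _ _).1 (hpow c u)
  have hfex' : ∀ u, f.symm (ex u) = ex (c⁻¹ • u) := fun u => by
    rw [Equiv.symm_apply_eq, hfex, smul_inv_smul₀ hc]
  refine ⟨Q, fun u v => ?_⟩
  have hg := hasLieTwoJet_lieCoordSymm_smul (I := I) G u
  have hh := hasLieTwoJet_lieCoordSymm_smul (I := I) G v
  set g : ℝ → G := fun ε => lieCoordSymm I (ε • u)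
  set h : ℝ → G := fun ε => lieCoordSymm I (ε • v)
  have hBg := hQ g _ _ hg
  have hBh := hQ h _ _ hh
  -- The jet of the inverse is only used for existence: multiplying the conjugate by `𝓑 g` on the
  -- right gives `𝓑 g * h`, and uniqueness of jets determines `z₁` and `z₂`.
  obtain ⟨z₁, z₂, hz⟩ : ∃ z₁ z₂ : E, HasLieTwoJet I (fun ε => 𝓑 (g ε) * h ε * (𝓑 (g ε))⁻¹) z₁ z₂ :=
    ⟨_, _, (hBg.mul hh).mul (hR _ _ _ hBg)⟩
  have hconj := hz.mul hBg
  simp only [inv_mul_cancel_right] at hconj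
  obtain ⟨e₁, e₂⟩ := hconj.2.unique (hBg.mul hh).2
  have hz₁ : z₁ = v := by
    rw [add_comm] at e₁
    exact add_left_cancel e₁
  subst hz₁
  have hz₂ : z₂ = lieCoordForm I G (B u) z₁ - lieCoordForm I G z₁ (B u) := by
    rw [eq_sub_iff_add_eq]
    refine add_left_cancel (a := B 0 + Q u u) (Eq.trans ?_ (e₂.trans ?_)) <;> abel
  have hright := hQ _ _ _ (hex c⁻¹ f.symm hfex' _ _ _
    ((hex c f hfex _ _ _ hg).mul (hex c f hfex _ _ _ hz)))
  have hleft := hBg.mul hBh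
  have heq : (fun ε => 𝓑 (g ε) * 𝓑 (h ε)) =
      fun ε => 𝓑 (f.symm (f (g ε) * f (𝓑 (g ε) * h ε * (𝓑 (g ε))⁻¹))) :=
    funext fun ε => hRB _ _
  rw [heq] at hleft
  have e := (hleft.2.unique hright.2).2
  have e₃ : c⁻¹ • (c • u + c • z₁) = u + z₁ := by
    rw [smul_add, inv_smul_smul₀ hc, inv_smul_smul₀ hc]
  rw [e₃] at e
  -- Second coefficient of the transported product. The terms in `(u, u)` and `(z₁, z₁)` cancel
  -- between `f` and `f.symm`.
  have e₄ : c⁻¹ • (c • (0 : E) + ((c ^ 2 - c) / 2) • lieCoordForm I G u u + (c • z₂ +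
      ((c ^ 2 - c) / 2) • lieCoordForm I G z₁ z₁) + lieCoordForm I G (c • u) (c • z₁)) +
      ((c⁻¹ ^ 2 - c⁻¹) / 2) • lieCoordForm I G (c • u + c • z₁) (c • u + c • z₁) =
      z₂ + c • lieCoordForm I G u z₁ +
        ((1 - c) / 2) • (lieCoordForm I G u z₁ + lieCoordForm I G z₁ u) := by
    simp only [map_add, map_smul, add_apply, smul_apply, smul_zero, zero_add]
    match_scalars <;> field_simp <;> ring
  rw [e₄, hz₂] at e
  simp only [map_zero, zero_add, map_add Q, map_add (Q u), map_add (Q z₁), add_apply] at e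
  -- The diagonal terms of `Q` occur on both sides; only the polarisation of `Q` survives.
  refine add_left_cancel (a := Q u u + Q z₁ z₁) (e.trans ?_)
  abel

end RotaBaxter

theorem mainTheorem8
    {E : Type*} [NormedAddCommGroup E] [NormedSpace ℝ E] [FiniteDimensional ℝ E]
    [CompleteSpace E]
    {H : Type*} [TopologicalSpace H] (I : ModelWithCorners ℝ E H) [I.Boundaryless]
    {G : Type*} [TopologicalSpace G] [ChartedSpace H G] [Group G] [LieGroup I ∞ G]
    (c : ℝ) (hc : c ≠ 0)
    (𝓑 : G → G) (h𝓑_smooth : ContMDiff I I ∞ 𝓑)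
    (h𝓑 : IsGroupRotaBaxterOperator I c 𝓑) :
    ∃ h1 : 𝓑 1 = 1, IsLieRotaBaxterOperator c (differentialAtOne I 𝓑 h1) := by
  refine ⟨h𝓑.map_one, ?_⟩
  let B : E →L[ℝ] E := mfderiv I I 𝓑 1
  obtain ⟨Q, hQ⟩ := h𝓑.exists_second_order hc h𝓑_smooth (B := B) rfl
  set β := lieCoordForm I G
  -- Subtracting the identity with `u` and `v` exchanged kills the symmetric terms: those in `Q` and
  -- the one with factor `(1 - c) / 2`.
  have key : ∀ u v : E, β (B u) (B v) - β (B v) (B u) =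
      B ((β (B u) v - β v (B u)) - (β (B v) u - β u (B v)) + c • (β u v - β v u)) := by
    intro u v
    rw [hQ u v, hQ v u]
    simp only [map_add, map_sub, map_smul]
    module
  intro u v
  have hbr : ∀ a b : GroupLieAlgebra I G, ⁅a, b⁆ = (β a b - β b a : E) :=
    GroupLieAlgebra.bracket_eq_lieCoordForm
  simp only [hbr]
  exact key u v
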